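/- Fix fading coefficients $h_1,h_2\in\mathbb C$, put $z_j=|h_j|^2$, and let $\{j,m\}=\{1,2\}$. Let $(x_1,x_2)$ be a pair of complex inputs with an arbitrary discrete (finite or countably infinite) joint law such that $\mathbb E|x_1|^2<\infty$ and $\mathbb E|x_2|^2<\infty$. The $j$-th receiver observes $$y_j=h_jx_j\sqrt{P_j}+h_jx_m\sqrt{P_m}+w_j,$$ where $w_j$ is independent of $(x_1,x_2)$ and is zero-mean circularly symmetric complex Gaussian with $\mathbb E|w_j|^2=1$ (density $\frac1\pi e^{-|w|^2}$), and $P_j>0$, $P_m\ge 0$. Let $f$ denote the (conditional) densities of $y_j$ in this model, let $\beta>1$, and put $$I(x_j;y_j)=\mathbb E\Big\{\log_\beta\frac{f_{y_j|x_j}(y_j|x_j)}{f_{y_j}(y_j)}\Big\},\qquad I(x_j;y_j|x_m)=\mathbb E\Big\{\log_\beta\frac{f_{y_j|x_j,x_m}(y_j|x_j,x_m)}{f_{y_j|x_m}(y_j|x_m)}\Big\}.$$ Let $\hat x_k(y_j)=\mathbb E\{x_k|y_j\}$ for $k\in\{1,2\}$, $\mathrm{MMSE}(x_j;y_j)=\mathbb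 E|x_j-\hat x_j(y_j)|^2$ and $\mathrm{MMSE}(x_j;y_j|x_m)=\mathbb E\big|x_j-\mathbb E\{x_j|y_j,x_m\}\big|^2$. Then, with $P_m$ held fixed, both mutual informations are differentiable in $P_j$ and $$\frac{dI(x_j;y_j)}{dP_j}=\frac1{\ln\beta}\Big(z_j\,\mathrm{MMSE}(x_j;y_j)+z_j\sqrt{\frac{P_m}{P_j}}\;\mathrm{Re}\,\mathbb E\big\{x_jx_m^*-\hat x_j(y_j)\hat x_m^*(y_j)\big\}\Big),$$ $$\frac{dI(x_j;y_j|x_m)}{dP_j}=\frac1{\ln\beta}\,z_j\,\mathrm{MMSE}(x_j;y_j|x_m).$$ In particular, with natural logarithms ($\beta=e$) the factor $1/\ln\beta$ equals $1$. -/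

import Mathlib

open MeasureTheory
open scoped ComplexConjugate

noncomputable section

namespace BroadcastChannel

/-- The density `w ↦ (1/π) exp(-|w|²)` of a zero-mean, circularly symmetric complex Gaussian
random variable of unit variance. -/
def noiseDensity (w : ℂ) : ℝ :=
  (1 / Real.pi) * Real.exp (-‖w‖ ^ 2)

/-- The law of the noise. -/
def noiseLaw : Measure ℂ :=
  volume.withDensity fun w => ENNReal.ofReal (noiseDensity w)

/-- The noiseless channel output `h (x₀ √P₀ + x₁ √P₁)`, for the input pair `x`, the powers `P` and
the fading coefficient `h` of the receiver under consideration. -/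
def signal (h : ℂ) (P : Fin 2 → ℝ) (x : Fin 2 → ℂ) : ℂ :=
  h * ∑ k, x k * (Real.sqrt (P k) : ℂ)

/-- The channel output `y = h x₀ √P₀ + h x₁ √P₁ + w`. -/
def output (h : ℂ) (P : Fin 2 → ℝ) (x : Fin 2 → ℂ) (w : ℂ) : ℂ :=
  signal h P x + w

/-- The density at `y` of the channel output given the input pair `x`. -/
def density (h : ℂ) (P : Fin 2 → ℝ) (x : Fin 2 → ℂ) (y : ℂ) : ℝ :=
  noiseDensity (y - signal h P x)

/-- The expectation of `g(x, y)`, where the input pair `x` has the discrete joint law `p` (its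
two components may be dependent), the noise is independent of `x`, and `y` is the output. -/
def expect {E : Type*} [NormedAddCommGroup E] [NormedSpace ℝ E] (p : PMF (Fin 2 → ℂ)) (h : ℂ)
    (P : Fin 2 → ℝ) (g : (Fin 2 → ℂ) → ℂ → E) : E :=
  ∫ ω : (Fin 2 → ℂ) × ℂ, g ω.1 (output h P ω.1 ω.2) ∂(p.toMeasure.prod noiseLaw)

/-- The density at `y` of the channel output given the event `x ∈ A`. -/
def condDensity (p : PMF (Fin 2 → ℂ)) (h : ℂ) (P : Fin 2 → ℝ) (A : Set (Fin 2 → ℂ)) (y : ℂ) : ℝ :=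
  (∑' x : A, (p x).toReal * density h P x y) / ∑' x : A, (p x).toReal

/-- The MMSE estimate of `x k` from the output value `y`, given the event `x ∈ A`: the mean of
`x k` under the conditional law of `x` given `y` and `x ∈ A`. -/
def estimate (p : PMF (Fin 2 → ℂ)) (h : ℂ) (P : Fin 2 → ℝ) (A : Set (Fin 2 → ℂ)) (k : Fin 2)
    (y : ℂ) : ℂ :=
  (∑' x : A, (((p x).toReal * density h P x y : ℝ) : ℂ) * (x : Fin 2 → ℂ) k) /
    ((∑' x : A, (p x).toReal * density h P x y : ℝ) : ℂ)

/-- The mutual information `I(x_j; y) = E log (f(y | x_j) / f(y))`, logarithm to base `β`. -/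
def mutualInfo (β : ℝ) (p : PMF (Fin 2 → ℂ)) (h : ℂ) (P : Fin 2 → ℝ) (j : Fin 2) : ℝ :=
  expect p h P fun x y =>
    Real.logb β (condDensity p h P {x' | x' j = x j} y / condDensity p h P Set.univ y)

/-- The conditional mutual information `E log (f(y | x_j, x_m) / f(y | x_m))` of `x_j` and `y`
given `x_m`, logarithm to base `β`; `x` is the pair formed by `x_j` and `x_m`. -/
def condMutualInfo (β : ℝ) (p : PMF (Fin 2 → ℂ)) (h : ℂ) (P : Fin 2 → ℝ) (m : Fin 2) : ℝ :=
  expect p h P fun x y =>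
    Real.logb β (density h P x y / condDensity p h P {x' | x' m = x m} y)

/-- `MMSE(x_j; y) = E |x_j - x̂_j(y)|²`. -/
def mmse (p : PMF (Fin 2 → ℂ)) (h : ℂ) (P : Fin 2 → ℝ) (j : Fin 2) : ℝ :=
  expect p h P fun x y => ‖x j - estimate p h P Set.univ j y‖ ^ 2

/-- `MMSE(x_j; y | x_m) = E |x_j - E(x_j | y, x_m)|²`. -/
def condMmse (p : PMF (Fin 2 → ℂ)) (h : ℂ) (P : Fin 2 → ℝ) (j m : Fin 2) : ℝ :=
  expect p h P fun x y => ‖x j - estimate p h P {x' | x' m = x m} j y‖ ^ 2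

end BroadcastChannel

end

/-! Attach a label `ℓ` to the input pair and let `J(u)` be the expected logarithm of the output
density given the label, for signals `s = u v + e` with `u = √P_j`, `v = h x_j`, `e = h √P_m x_m`.
Up to the factor `1 / ln β`, `I(x_j; y)` is `J` for the label `x_j` minus `J` for the trivial label,
and `I(x_j; y | x_m)` is a constant minus `J` for the label `x_m`. Everything rests on the
derivative of `J`.

Nothing is differentiated under the integral. Fix the input and the noise and move the signals from
`s` to `s + δ v`: the ratio of the new density to the old one is a posterior average of
exponentials, so Jensen's inequality (`classMean_log_le`) bounds its logarithm below by the
posterior mean of the change of the Gaussian exponent (`logDensity_sub_ge`). Integrating, with the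
tower property (`integrable_classMean`) and the zero mean of the noise, gives `J(u') - J(u) ≥ (u' -
u) A(u) - C (u' - u)²`, where `A = -2 Re E[conj(s - ŝ) v]` and hats are posterior means. Exchanging
`u` and `u'` gives the matching upper bound, so `J' = A` once `A` is continuous
(`hasDerivAt_of_quadratic_lower_bound`); continuity comes from Pratt's lemma.

Linearity and orthogonality turn `A` into `-2 (u E|v - v̂|² + Re E[conj(e - ê) v])`. For the label
`x_j` this vanishes, for `x_m` only the first term survives, and for the trivial label both do. The
chain rule through `u = √P_j` finishes the proof. -/

namespace BroadcastChannel

/-! ### Weighted means over the classes of a label: discrete conditional expectation. -/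

section ClassMean

variable {ι κ E : Type*} [NormedAddCommGroup E] [NormedSpace ℝ E]

/-- The mean of `φ` over the class `{k | ℓ k = c}`, with weights `r`. -/
noncomputable def classMean (r : ι → ℝ) (ℓ : ι → κ) (φ : ι → E) (c : κ) : E :=
  (∑' k : {k // ℓ k = c}, r k)⁻¹ • ∑' k : {k // ℓ k = c}, r k • φ k

variable {r : ι → ℝ} {ℓ : ι → κ} {φ ψ : ι → E}

omit [NormedSpace ℝ E] in
theorem summable_fiber [CompleteSpace E] (hφ : Summable φ) (c : κ) :
    Summable fun k : {k // ℓ k = c} => φ k :=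
  hφ.subtype {k | ℓ k = c}

theorem classWeight_pos (hr : ∀ i, 0 < r i) (hrs : Summable r) (i : ι) :
    0 < ∑' k : {k // ℓ k = ℓ i}, r k :=
  (summable_fiber hrs (ℓ i)).tsum_pos (fun k => (hr k).le) ⟨i, rfl⟩ (hr i)

theorem classWeight_nonneg (hr : ∀ i, 0 < r i) (c : κ) :
    0 ≤ ∑' k : {k // ℓ k = c}, r k :=
  tsum_nonneg fun k => (hr k).le

theorem norm_classMean_le [CompleteSpace E] (hr : ∀ i, 0 < r i)
    (hφ : Summable fun i => r i * ‖φ i‖) (c : κ) :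
    ‖classMean r ℓ φ c‖ ≤ classMean r ℓ (fun i => ‖φ i‖) c := by
  unfold classMean
  rw [norm_smul, norm_inv, Real.norm_of_nonneg (classWeight_nonneg hr c), smul_eq_mul]
  refine mul_le_mul_of_nonneg_left ?_ (inv_nonneg.2 (classWeight_nonneg hr c))
  have e : ∀ k, ‖r k • φ k‖ = r k * ‖φ k‖ := fun k => by
    rw [norm_smul, Real.norm_of_nonneg (hr k).le]
  refine (norm_tsum_le_tsum_norm ?_).trans_eq ?_
  · simp only [e]; exact hφ.subtype {k | ℓ k = c}
  · simp only [e, smul_eq_mul]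

theorem classMean_nonneg {φ : ι → ℝ} (hr : ∀ i, 0 < r i) (hφ : ∀ i, 0 ≤ φ i) (c : κ) :
    0 ≤ classMean r ℓ φ c :=
  mul_nonneg (inv_nonneg.2 (classWeight_nonneg hr c))
    (tsum_nonneg fun k => mul_nonneg (hr k).le (hφ k))

theorem classMean_add (hφ : Summable fun i => r i • φ i) (hψ : Summable fun i => r i • ψ i)
    [CompleteSpace E] (c : κ) :
    classMean r ℓ (fun i => φ i + ψ i) c = classMean r ℓ φ c + classMean r ℓ ψ c := by
  unfold classMean
  simp only [smul_add]
  rw [Summable.tsum_add (summable_fiber hφ c) (summable_fiber hψ c), smul_add]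

theorem classMean_sub (hφ : Summable fun i => r i • φ i) (hψ : Summable fun i => r i • ψ i)
    [CompleteSpace E] (c : κ) :
    classMean r ℓ (fun i => φ i - ψ i) c = classMean r ℓ φ c - classMean r ℓ ψ c := by
  unfold classMean
  simp only [smul_sub]
  rw [Summable.tsum_sub (summable_fiber hφ c) (summable_fiber hψ c), smul_sub]

theorem classMean_congr {c : κ} (h : ∀ k, ℓ k = c → φ k = ψ k) :
    classMean r ℓ φ c = classMean r ℓ ψ c := by
  unfold classMean
  congr 1
  exact tsum_congr fun k => by rw [h k k.2]

theorem classMean_const (hr : ∀ i, 0 < r i) (hrs : Summable r) (x : E) (i : ι) :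
    classMean r ℓ (fun _ => x) (ℓ i) = x := by
  unfold classMean
  have h := hrs.subtype {k | ℓ k = ℓ i}
  have e : ∑' k : {k // ℓ k = ℓ i}, r k • x = (∑' k : {k // ℓ k = ℓ i}, r k) • x :=
    h.tsum_smul_const x
  rw [e, smul_smul, inv_mul_cancel₀ (classWeight_pos hr hrs i).ne', one_smul]

theorem classMean_clm {F : Type*} [NormedAddCommGroup F] [NormedSpace ℝ F] [CompleteSpace E]
    (T : E →L[ℝ] F) (hφ : Summable fun i => r i • φ i) (c : κ) :
    classMean r ℓ (fun i => T (φ i)) c = T (classMean r ℓ φ c) := by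
  unfold classMean
  rw [map_smul, T.map_tsum (summable_fiber hφ c)]
  simp only [map_smul]

theorem classWeight_smul_classMean (hr : ∀ i, 0 < r i) (hrs : Summable r) (i : ι) :
    (∑' k : {k // ℓ k = ℓ i}, r k) • classMean r ℓ φ (ℓ i)
      = ∑' k : {k // ℓ k = ℓ i}, r k • φ k := by
  unfold classMean
  rw [smul_smul, mul_inv_cancel₀ (classWeight_pos hr hrs i).ne', one_smul]

theorem classWeight_smul_classMean' (hr : ∀ i, 0 < r i) (hrs : Summable r) (c : κ) :
    (∑' k : {k // ℓ k = c}, r k) • classMean r ℓ φ c = ∑' k : {k // ℓ k = c}, r k • φ k := by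
  rcases isEmpty_or_nonempty {k // ℓ k = c} with h | ⟨⟨i, rfl⟩⟩
  · simp
  · exact classWeight_smul_classMean hr hrs i

theorem tsum_fiber_classMean (hr : ∀ i, 0 < r i) (hrs : Summable r) (c : κ) :
    ∑' k : {k // ℓ k = c}, r k • classMean r ℓ φ (ℓ k) = ∑' k : {k // ℓ k = c}, r k • φ k := by
  rw [← classWeight_smul_classMean' hr hrs c]
  have e : ∀ k : {k // ℓ k = c}, r k • classMean r ℓ φ (ℓ k) = r k • classMean r ℓ φ c :=
    fun k => by rw [k.2]
  simp only [e]
  exact (hrs.subtype {k | ℓ k = c}).tsum_smul_const _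

/-- The classes partition `ι` and averaging preserves the sum over each class; for nonnegative
terms, summability over the partition is decided by the class sums. -/
theorem summable_mul_classMean_of_nonneg {φ : ι → ℝ} (hr : ∀ i, 0 < r i) (hrs : Summable r)
    (hφ0 : ∀ i, 0 ≤ φ i) (hφ : Summable fun i => r i * φ i) :
    Summable fun i => r i * classMean r ℓ φ (ℓ i) := by
  have h1 := ((Equiv.sigmaFiberEquiv ℓ).summable_iff (f := fun i => r i * φ i)).2 hφ
  have h1 := (summable_sigma_of_nonneg fun x => mul_nonneg (hr _).le (hφ0 _)).1 h1
  refine (Equiv.sigmaFiberEquiv ℓ).summable_iff.1 ((summable_sigma_of_nonneg fun x =>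
    mul_nonneg (hr _).le (classMean_nonneg hr hφ0 _)).2 ?_)
  refine ⟨fun c => ?_, ?_⟩
  · have e : ∀ k : {k // ℓ k = c}, r k * classMean r ℓ φ (ℓ k) = r k * classMean r ℓ φ c :=
      fun k => by rw [k.2]
    refine ((hrs.subtype {k | ℓ k = c}).mul_right (classMean r ℓ φ c)).congr fun k => ?_
    exact (e k).symm
  · refine h1.2.congr fun c => ?_
    exact (tsum_fiber_classMean (φ := φ) hr hrs c).symm

theorem summable_norm_classMean [CompleteSpace E] (hr : ∀ i, 0 < r i) (hrs : Summable r)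
    (hφ : Summable fun i => r i * ‖φ i‖) :
    Summable fun i => r i * ‖classMean r ℓ φ (ℓ i)‖ :=
  (summable_mul_classMean_of_nonneg hr hrs (fun i => norm_nonneg (φ i)) hφ).of_nonneg_of_le
    (fun i => mul_nonneg (hr i).le (norm_nonneg _))
    (fun i => mul_le_mul_of_nonneg_left (norm_classMean_le hr hφ _) (hr i).le)

theorem summable_smul_of_norm [CompleteSpace E] (hr : ∀ i, 0 < r i)
    (hφ : Summable fun i => r i * ‖φ i‖) : Summable fun i => r i • φ i :=
  Summable.of_norm (by simpa only [norm_smul, Real.norm_of_nonneg (hr _).le] using hφ)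

/-- The tower property of `classMean`. -/
theorem tsum_smul_classMean [CompleteSpace E] (hr : ∀ i, 0 < r i) (hrs : Summable r)
    (hφ : Summable fun i => r i * ‖φ i‖) :
    ∑' i, r i • classMean r ℓ φ (ℓ i) = ∑' i, r i • φ i := by
  have h1 := summable_smul_of_norm hr hφ
  have h2 := summable_smul_of_norm hr (summable_norm_classMean (ℓ := ℓ) hr hrs hφ)
  rw [← (Equiv.sigmaFiberEquiv ℓ).tsum_eq, ← (Equiv.sigmaFiberEquiv ℓ).tsum_eq (fun i => r i • φ i)]
  refine (Summable.tsum_sigma ((Equiv.sigmaFiberEquiv ℓ).summable_iff.2 h2)).trans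
    (Eq.trans ?_ (Summable.tsum_sigma ((Equiv.sigmaFiberEquiv ℓ).summable_iff.2 h1)).symm)
  exact tsum_congr fun c => tsum_fiber_classMean hr hrs c

/-- Conditional expectation contracts `L¹`; this makes posterior means integrable over the outputs.
-/
theorem tsum_mul_norm_classMean_le [CompleteSpace E] (hr : ∀ i, 0 < r i) (hrs : Summable r)
    (hφ : Summable fun i => r i * ‖φ i‖) :
    ∑' i, r i * ‖classMean r ℓ φ (ℓ i)‖ ≤ ∑' i, r i * ‖φ i‖ := by
  have e := tsum_smul_classMean (φ := fun i => ‖φ i‖) (ℓ := ℓ) hr hrs (by simpa using hφ)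
  simp only [smul_eq_mul] at e
  rw [← e]
  refine Summable.tsum_le_tsum
    (fun i => mul_le_mul_of_nonneg_left (norm_classMean_le hr hφ _) (hr i).le)
    (summable_norm_classMean hr hrs hφ)
    (summable_mul_classMean_of_nonneg hr hrs (fun i => norm_nonneg (φ i)) hφ)

/-- Jensen's inequality for the logarithm of a ratio of class weights. -/
theorem classMean_log_le {r' : ι → ℝ} {d : ι → ℝ} (hr : ∀ i, 0 < r i) (hrs : Summable r)
    (hrs' : Summable r') (hd : ∀ i, r' i = r i * Real.exp (d i))
    (hrd : Summable fun i => r i * |d i|) (i : ι) :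
    classMean r ℓ d (ℓ i) ≤
      Real.log (∑' k : {k // ℓ k = ℓ i}, r' k) - Real.log (∑' k : {k // ℓ k = ℓ i}, r k) := by
  have hr' : ∀ i, 0 < r' i := fun i => by rw [hd]; exact mul_pos (hr i) (Real.exp_pos _)
  have hR := classWeight_pos (ℓ := ℓ) hr hrs i
  have hR' := classWeight_pos (ℓ := ℓ) hr' hrs' i
  set R := ∑' k : {k // ℓ k = ℓ i}, r k with hRdef
  set R' := ∑' k : {k // ℓ k = ℓ i}, r' k with hRdef'
  have hsd : Summable fun k : {k // ℓ k = ℓ i} => r k * d k :=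
    (summable_smul_of_norm (φ := d) hr (by simpa using hrd)).subtype {k | ℓ k = ℓ i}
  have hs : Summable fun k : {k // ℓ k = ℓ i} => r k := hrs.subtype {k | ℓ k = ℓ i}
  have hs' : Summable fun k : {k // ℓ k = ℓ i} => r' k := hrs'.subtype {k | ℓ k = ℓ i}
  set L := Real.log R' - Real.log R with hL
  have hexp : Real.exp (-L) = R / R' := by
    rw [hL, neg_sub, Real.exp_sub, Real.exp_log hR, Real.exp_log hR']
  -- This is `1 + t ≤ exp t` at `t = d k - L`. Since `exp (-L) = R / R'`, the terms `r' k * (R /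
  -- R')` sum to `R` and cancel the sum of the `r k`.
  have key : ∀ k : {k // ℓ k = ℓ i}, r k * d k ≤ r' k * (R / R') - r k + r k * L := fun k => by
    have h1 : d k - L + 1 ≤ Real.exp (d k) * (R / R') := by
      rw [← hexp, ← Real.exp_add, ← sub_eq_add_neg]; exact Real.add_one_le_exp _
    have := mul_le_mul_of_nonneg_left h1 (hr k).le
    rw [hd]; linarith
  have h2 := Summable.tsum_le_tsum key hsd (((hs'.mul_right _).sub hs).add (hs.mul_right _))
  rw [Summable.tsum_add ((hs'.mul_right _).sub hs) (hs.mul_right _),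
    Summable.tsum_sub (hs'.mul_right _) hs, tsum_mul_right, tsum_mul_right, ← hRdef, ← hRdef',
    mul_div_cancel₀ _ hR'.ne', sub_self, zero_add] at h2
  unfold classMean
  rw [← hRdef, smul_eq_mul, inv_mul_le_iff₀ hR]
  exact h2

end ClassMean

/-! ### Gaussian noise: finiteness, second moment, zero mean. -/

section Noise

theorem noiseDensity_pos (w : ℂ) : 0 < noiseDensity w := by
  unfold noiseDensity; positivity

theorem noiseDensity_le (w : ℂ) : noiseDensity w ≤ 1 / Real.pi := by
  unfold noiseDensity
  have : Real.exp (-‖w‖ ^ 2) ≤ 1 := Real.exp_le_one_iff.2 (neg_nonpos.2 (sq_nonneg _))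
  exact mul_le_of_le_one_right (by positivity) this

@[fun_prop]
theorem continuous_noiseDensity : Continuous noiseDensity := by
  unfold noiseDensity; fun_prop

@[fun_prop]
theorem measurable_noiseDensity : Measurable noiseDensity :=
  continuous_noiseDensity.measurable

theorem log_noiseDensity (w : ℂ) : Real.log (noiseDensity w) = -Real.log Real.pi - ‖w‖ ^ 2 := by
  unfold noiseDensity
  rw [Real.log_mul (by positivity) (Real.exp_ne_zero _), Real.log_exp, one_div, Real.log_inv]
  ring

theorem noiseDensity_neg (w : ℂ) : noiseDensity (-w) = noiseDensity w := by
  simp [noiseDensity]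

theorem integrable_exp_neg_mul_norm_sq {b : ℝ} (hb : 0 < b) :
    Integrable fun w : ℂ => Real.exp (-b * ‖w‖ ^ 2) := by
  have h := (GaussianFourier.integrable_cexp_neg_mul_sq_norm_add (V := ℂ) (b := (b : ℂ))
    (by simpa using hb) 0 0).norm
  refine h.congr (Filter.Eventually.of_forall fun w => ?_)
  simp [Complex.norm_exp, ← Complex.ofReal_pow]

theorem integrable_noiseLaw_iff {E : Type*} [NormedAddCommGroup E] [NormedSpace ℝ E] {f : ℂ → E} :
    Integrable f noiseLaw ↔ Integrable fun w => noiseDensity w • f w := by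
  unfold noiseLaw
  rw [integrable_withDensity_iff_integrable_smul' (by fun_prop) (by simp)]
  simp only [ENNReal.toReal_ofReal (noiseDensity_pos _).le]

theorem integral_noiseLaw {E : Type*} [NormedAddCommGroup E] [NormedSpace ℝ E] (f : ℂ → E) :
    ∫ w, f w ∂noiseLaw = ∫ w, noiseDensity w • f w := by
  unfold noiseLaw
  rw [integral_withDensity_eq_integral_toReal_smul (by fun_prop) (by simp)]
  simp only [ENNReal.toReal_ofReal (noiseDensity_pos _).le]

/-- Finiteness is all that the argument needs of the total mass. -/
instance : IsFiniteMeasure noiseLaw := by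
  refine isFiniteMeasure_withDensity_ofReal (Integrable.hasFiniteIntegral ?_)
  refine ((integrable_exp_neg_mul_norm_sq one_pos).const_mul (1 / Real.pi)).congr
    (Filter.Eventually.of_forall fun w => ?_)
  simp [noiseDensity]

theorem memLp_noise : MemLp (fun w : ℂ => w) 2 noiseLaw := by
  rw [memLp_two_iff_integrable_sq_norm (by fun_prop), integrable_noiseLaw_iff]
  refine ((integrable_exp_neg_mul_norm_sq (b := 1 / 2) (by norm_num)).const_mul
    (2 / Real.pi)).mono' (by fun_prop) (Filter.Eventually.of_forall fun w => ?_)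
  rw [Real.norm_of_nonneg (smul_nonneg (noiseDensity_pos w).le (sq_nonneg _)), smul_eq_mul,
    noiseDensity]
  -- Half of the Gaussian exponent is spent on absorbing the second moment.
  have h1 : ‖w‖ ^ 2 ≤ 2 * Real.exp (1 / 2 * ‖w‖ ^ 2) := by
    have := Real.add_one_le_exp (1 / 2 * ‖w‖ ^ 2)
    linarith
  have h2 : Real.exp (-(1 / 2) * ‖w‖ ^ 2) = Real.exp (-‖w‖ ^ 2) * Real.exp (1 / 2 * ‖w‖ ^ 2) := by
    rw [← Real.exp_add]; congr 1; ring
  rw [h2]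
  calc 1 / Real.pi * Real.exp (-‖w‖ ^ 2) * ‖w‖ ^ 2
      ≤ 1 / Real.pi * Real.exp (-‖w‖ ^ 2) * (2 * Real.exp (1 / 2 * ‖w‖ ^ 2)) :=
        mul_le_mul_of_nonneg_left h1 (by positivity)
    _ = _ := by ring

theorem integral_noise : ∫ w : ℂ, w ∂noiseLaw = 0 := by
  rw [integral_noiseLaw]
  have h := integral_neg_eq_self (fun w : ℂ => noiseDensity w • w) volume
  simp only [noiseDensity_neg, smul_neg, integral_neg] at h
  exact self_eq_neg.1 h.symm

end Noise

/-! ### Joint law of input and noise, change of variables to the output, tower property. -/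

section JointLaw

variable {ι : Type*} [MeasurableSpace ι]

/-- The measure on `ι` with mass `q i` at `i`. -/
noncomputable def inputLaw (q : ι → ℝ) : Measure ι :=
  Measure.count.withDensity fun i => ENNReal.ofReal (q i)

/-- The joint law of the input index and the independent noise. -/
noncomputable def jointLaw (q : ι → ℝ) : Measure (ι × ℂ) :=
  (inputLaw q).prod noiseLaw

/-- The weight of the input index `i` when the output is `y` and the signals are `s`. -/
noncomputable def outputWeight (q : ι → ℝ) (s : ι → ℂ) (y : ℂ) (i : ι) : ℝ :=
  q i * noiseDensity (y - s i)

variable {q : ι → ℝ} {s : ι → ℂ} {E : Type*} [NormedAddCommGroup E] [NormedSpace ℝ E]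

omit [MeasurableSpace ι] in
theorem outputWeight_pos (hq : ∀ i, 0 < q i) (y : ℂ) (i : ι) : 0 < outputWeight q s y i :=
  mul_pos (hq i) (noiseDensity_pos _)

omit [MeasurableSpace ι] in
theorem outputWeight_le (hq : ∀ i, 0 < q i) (y : ℂ) (i : ι) :
    outputWeight q s y i ≤ q i * (1 / Real.pi) :=
  mul_le_mul_of_nonneg_left (noiseDensity_le _) (hq i).le

omit [MeasurableSpace ι] in
theorem summable_outputWeight_mul (hq : ∀ i, 0 < q i) {f : ι → ℝ} (hf0 : ∀ i, 0 ≤ f i)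
    (hf : Summable fun i => q i * f i) (y : ℂ) :
    Summable fun i => outputWeight q s y i * f i := by
  refine (hf.mul_left (1 / Real.pi)).of_nonneg_of_le
    (fun i => mul_nonneg (outputWeight_pos hq y i).le (hf0 i)) fun i => ?_
  calc outputWeight q s y i * f i ≤ q i * (1 / Real.pi) * f i :=
        mul_le_mul_of_nonneg_right (outputWeight_le hq y i) (hf0 i)
    _ = _ := by ring

omit [MeasurableSpace ι] in
theorem summable_outputWeight (hq : ∀ i, 0 < q i) (hqs : Summable q) (y : ℂ) :
    Summable (outputWeight q s y) := by
  simpa using summable_outputWeight_mul (s := s) (f := fun _ => 1) hq (fun _ => zero_le_one)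
    (by simpa using hqs) y

variable [DiscreteMeasurableSpace ι]

theorem integrable_inputLaw_iff (hq : ∀ i, 0 < q i) {f : ι → E} :
    Integrable f (inputLaw q) ↔ Summable fun i => q i * ‖f i‖ := by
  unfold inputLaw
  rw [integrable_withDensity_iff_integrable_smul' (by fun_prop) (by simp),
    integrable_count_iff]
  simp only [ENNReal.toReal_ofReal (hq _).le, norm_smul, Real.norm_of_nonneg (hq _).le]

theorem isFiniteMeasure_inputLaw (hq : ∀ i, 0 < q i) (hqs : Summable q) :
    IsFiniteMeasure (inputLaw q) := by
  have h : Integrable (fun _ => (1 : ℝ)) (inputLaw q) :=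
    (integrable_inputLaw_iff hq).2 (by simpa using hqs)
  rwa [integrable_const_iff_isFiniteMeasure one_ne_zero] at h

/-- The shear mapping the input index and the noise to the input index and the output. -/
def outputEquiv (s : ι → ℂ) [Countable ι] : ι × ℂ ≃ᵐ ι × ℂ where
  toFun ω := (ω.1, s ω.1 + ω.2)
  invFun ω := (ω.1, ω.2 - s ω.1)
  left_inv ω := by simp
  right_inv ω := by simp
  measurable_toFun := by
    exact measurable_fst.prodMk
      (((measurable_of_countable s).comp measurable_fst).add measurable_snd)
  measurable_invFun := by
    exact measurable_fst.prodMk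
      (measurable_snd.sub ((measurable_of_countable s).comp measurable_fst))

variable [Countable ι]

theorem measurable_of_forall_left {F : Type*} [MeasurableSpace F] {f : ι × ℂ → F}
    (hf : ∀ i, Measurable fun w => f (i, w)) : Measurable f :=
  measurable_from_prod_countable_right hf

theorem measurePreserving_outputEquiv (s : ι → ℂ) :
    MeasurePreserving (outputEquiv s) ((Measure.count : Measure ι).prod volume)
      ((Measure.count : Measure ι).prod volume) :=
  MeasurePreserving.skew_product (g := fun i w => s i + w) (MeasurePreserving.id _)
    (((measurable_of_countable s).comp measurable_fst).add measurable_snd)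
    (Filter.Eventually.of_forall fun i => (measurePreserving_add_left volume (s i)).map_eq)

omit [Countable ι] in
theorem jointLaw_eq (hq : ∀ i, 0 < q i) :
    jointLaw q = ((Measure.count : Measure ι).prod volume).withDensity
      fun ω => ENNReal.ofReal (q ω.1 * noiseDensity ω.2) := by
  unfold jointLaw inputLaw noiseLaw
  rw [prod_withDensity (by fun_prop) (by fun_prop)]
  simp only [ENNReal.ofReal_mul (hq _).le]

theorem measurable_jointDensity : Measurable fun ω : ι × ℂ => q ω.1 * noiseDensity ω.2 :=
  ((measurable_of_countable q).comp measurable_fst).mul (by fun_prop)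

/-- The shear from noise to output preserves counting times Lebesgue measure. Afterwards the output
is a free coordinate, and on the slice over `y` the indices carry their unnormalised posterior
weights. -/
theorem integrable_jointLaw_output_iff (hq : ∀ i, 0 < q i) (s : ι → ℂ) {Ψ : ι → ℂ → E} :
    Integrable (fun ω : ι × ℂ => Ψ ω.1 (s ω.1 + ω.2)) (jointLaw q) ↔
      Integrable (fun ω : ι × ℂ => outputWeight q s ω.2 ω.1 • Ψ ω.1 ω.2)
        (Measure.count.prod volume) := by
  rw [jointLaw_eq hq, integrable_withDensity_iff_integrable_smul'
    measurable_jointDensity.ennreal_ofReal (by simp),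
    ← (measurePreserving_outputEquiv s).integrable_comp_emb (outputEquiv s).measurableEmbedding
      (g := fun ω : ι × ℂ => outputWeight q s ω.2 ω.1 • Ψ ω.1 ω.2)]
  refine integrable_congr (Filter.Eventually.of_forall fun ω => ?_)
  simp [outputEquiv, outputWeight,
    ENNReal.toReal_ofReal (mul_pos (hq _) (noiseDensity_pos _)).le]

theorem integral_jointLaw_output (hq : ∀ i, 0 < q i) (s : ι → ℂ) (Ψ : ι → ℂ → E) :
    ∫ ω, Ψ ω.1 (s ω.1 + ω.2) ∂jointLaw q =
      ∫ ω, outputWeight q s ω.2 ω.1 • Ψ ω.1 ω.2 ∂(Measure.count : Measure ι).prod volume := by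
  rw [jointLaw_eq hq, integral_withDensity_eq_integral_toReal_smul
    measurable_jointDensity.ennreal_ofReal (by simp),
    ← (measurePreserving_outputEquiv s).integral_comp (outputEquiv s).measurableEmbedding
      (fun ω : ι × ℂ => outputWeight q s ω.2 ω.1 • Ψ ω.1 ω.2)]
  refine integral_congr_ae (Filter.Eventually.of_forall fun ω => ?_)
  simp [outputEquiv, outputWeight,
    ENNReal.toReal_ofReal (mul_pos (hq _) (noiseDensity_pos _)).le]

variable {κ : Type*} {ℓ : ι → κ} [CompleteSpace E] [MeasurableSpace E] [BorelSpace E]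
  [SecondCountableTopology E]

omit [Countable ι] [DiscreteMeasurableSpace ι] [MeasurableSpace ι] in
theorem measurable_outputWeight (i : ι) : Measurable fun y => outputWeight q s y i := by
  unfold outputWeight; fun_prop

omit [MeasurableSpace ι] [DiscreteMeasurableSpace ι] in
theorem measurable_classMean {Φ : ι → ℂ → E} (hΦ : ∀ i, Measurable (Φ i)) (c : κ) :
    Measurable fun y => classMean (outputWeight q s y) ℓ (fun k => Φ k y) c := by
  unfold classMean
  exact (Measurable.tsum fun k => measurable_outputWeight _).inv.smul
    (Measurable.tsum fun k => (measurable_outputWeight _).smul (hΦ k))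

theorem measurable_classMean_output {Φ : ι → ℂ → E} (hΦ : ∀ i, Measurable (Φ i)) :
    Measurable fun ω : ι × ℂ =>
      classMean (outputWeight q s (s ω.1 + ω.2)) ℓ (fun k => Φ k (s ω.1 + ω.2)) (ℓ ω.1) :=
  measurable_of_forall_left fun i =>
    (measurable_classMean hΦ (ℓ i)).comp (measurable_const_add (s i))

/-- In the coordinates (index, output), each slice over a fixed output is a weighted sum, to which
the discrete tower property and `L¹` contraction apply; Fubini assembles the slices. `Φ` may depend
on the output as well as on the index. -/
theorem integrable_classMean (hq : ∀ i, 0 < q i) (hqs : Summable q) {Φ : ι → ℂ → E}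
    (hm : ∀ i, Measurable (Φ i))
    (hΦ : Integrable (fun ω : ι × ℂ => Φ ω.1 (s ω.1 + ω.2)) (jointLaw q)) :
    Integrable (fun ω : ι × ℂ =>
      classMean (outputWeight q s (s ω.1 + ω.2)) ℓ (fun k => Φ k (s ω.1 + ω.2)) (ℓ ω.1))
      (jointLaw q) ∧
    ∫ ω, classMean (outputWeight q s (s ω.1 + ω.2)) ℓ (fun k => Φ k (s ω.1 + ω.2)) (ℓ ω.1)
      ∂jointLaw q = ∫ ω, Φ ω.1 (s ω.1 + ω.2) ∂jointLaw q := by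
  rw [integrable_jointLaw_output_iff hq s (Ψ := Φ)] at hΦ
  rw [integrable_jointLaw_output_iff hq s
      (Ψ := fun i y => classMean (outputWeight q s y) ℓ (fun k => Φ k y) (ℓ i)),
    integral_jointLaw_output hq s Φ, integral_jointLaw_output hq s
      (fun i y => classMean (outputWeight q s y) ℓ (fun k => Φ k y) (ℓ i))]
  have hw := outputWeight_pos (s := s) hq
  have hws := summable_outputWeight (s := s) hq hqs
  have hsec : ∀ᵐ y : ℂ, Summable fun i => outputWeight q s y i * ‖Φ i y‖ := by
    filter_upwards [hΦ.prod_left_ae] with y hy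
    simpa only [integrable_count_iff, norm_smul, Real.norm_of_nonneg (hw y _).le] using hy
  have hint : Integrable (fun ω : ι × ℂ => outputWeight q s ω.2 ω.1 •
      classMean (outputWeight q s ω.2) ℓ (fun k => Φ k ω.2) (ℓ ω.1))
      (Measure.count.prod volume) := by
    have hmeas : Measurable fun ω : ι × ℂ => outputWeight q s ω.2 ω.1 •
        classMean (outputWeight q s ω.2) ℓ (fun k => Φ k ω.2) (ℓ ω.1) :=
      measurable_of_forall_left fun i =>
        (measurable_outputWeight i).smul (measurable_classMean hm (ℓ i))
    refine (integrable_prod_iff' hmeas.aestronglyMeasurable).2 ⟨?_, ?_⟩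
    · filter_upwards [hsec] with y hy
      simpa only [integrable_count_iff, norm_smul, Real.norm_of_nonneg (hw y _).le] using
        summable_norm_classMean (ℓ := ℓ) (hw y) (hws y) hy
    · refine hΦ.integral_norm_prod_right.mono'
        hmeas.norm.stronglyMeasurable.integral_prod_left'.aestronglyMeasurable ?_
      filter_upwards [hsec] with y hy
      rw [Real.norm_of_nonneg (integral_nonneg fun _ => norm_nonneg _)]
      simp only [norm_smul, Real.norm_of_nonneg (hw y _).le]
      rw [integral_countable, integral_countable]
      · simpa using tsum_mul_norm_classMean_le (ℓ := ℓ) (hw y) (hws y) hy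
      · simpa [integrable_count_iff, abs_of_pos (hw y _)] using hy
      · simpa [integrable_count_iff, abs_of_pos (hw y _)] using
          summable_norm_classMean (ℓ := ℓ) (hw y) (hws y) hy
  refine ⟨hint, ?_⟩
  rw [integral_prod_symm _ hint, integral_prod_symm _ hΦ]
  refine integral_congr_ae ?_
  filter_upwards [hsec] with y hy
  rw [integral_countable, integral_countable]
  · simpa using tsum_smul_classMean (ℓ := ℓ) (hw y) (hws y) hy
  · simpa only [integrable_count_iff, norm_smul, Real.norm_of_nonneg (hw y _).le] using hy
  · simpa only [integrable_count_iff, norm_smul, Real.norm_of_nonneg (hw y _).le] using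
      summable_norm_classMean (ℓ := ℓ) (hw y) (hws y) hy

end JointLaw

/-! ### Pratt's lemma. -/

section GeneralizedDominatedConvergence

open Filter Topology

/-- The dominated convergence theorem with a convergent family of bounds (Pratt's lemma). -/
theorem tendsto_integral_of_tendsto_bound {α β E : Type*} [MeasurableSpace α]
    [NormedAddCommGroup E] [NormedSpace ℝ E] {μ : Measure α} {l : Filter β} [l.NeBot]
    [l.IsCountablyGenerated] {F : β → α → E} {f : α → E} {G : β → α → ℝ} {g : α → ℝ}
    (hF : ∀ b, AEStronglyMeasurable (F b) μ) (hf : AEStronglyMeasurable f μ)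
    (hG : ∀ b, Integrable (G b) μ) (hg : Integrable g μ) (hFG : ∀ b a, ‖F b a‖ ≤ G b a)
    (hFf : ∀ a, Tendsto (F · a) l (𝓝 (f a))) (hGg : ∀ a, Tendsto (G · a) l (𝓝 (g a)))
    (hint : Tendsto (fun b => ∫ a, G b a ∂μ) l (𝓝 (∫ a, g a ∂μ))) :
    Tendsto (fun b => ∫ a, F b a ∂μ) l (𝓝 (∫ a, f a ∂μ)) := by
  have hfg : ∀ a, ‖f a‖ ≤ g a := fun a =>
    le_of_tendsto_of_tendsto (hFf a).norm (hGg a) (Eventually.of_forall fun b => hFG b a)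
  have hG0 : ∀ b a, 0 ≤ G b a := fun b a => (norm_nonneg _).trans (hFG b a)
  have hg0 : ∀ a, 0 ≤ g a := fun a => (norm_nonneg _).trans (hfg a)
  have hFi : ∀ b, Integrable (F b) μ := fun b =>
    (hG b).mono' (hF b) (Eventually.of_forall (hFG b))
  have hfi : Integrable f μ := hg.mono' hf (Eventually.of_forall hfg)
  have hmin : ∀ b, Integrable (fun a => min (G b a) (g a)) μ := fun b => (hG b).inf hg
  have hm : ∀ b, AEStronglyMeasurable (fun a => min ‖F b a - f a‖ (2 * g a)) μ := fun b =>
    ((hF b).sub hf).norm.inf (hg.aestronglyMeasurable.const_mul 2)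
  have hbd : ∀ b a, ‖min ‖F b a - f a‖ (2 * g a)‖ ≤ 2 * g a := fun b a => by
    rw [Real.norm_of_nonneg (le_min (norm_nonneg _) (mul_nonneg zero_le_two (hg0 a)))]
    exact min_le_right _ _
  -- Truncated at `2 g`, the error has a fixed majorant. As `‖F - f‖ ≤ G + g`, what the truncation
  -- removes is at most `G - min G g`, whose integral tends to zero because `∫ G → ∫ g`.
  have h1 : Tendsto (fun b => ∫ a, min ‖F b a - f a‖ (2 * g a) ∂μ) l (𝓝 (∫ _a, 0 ∂μ)) := by
    refine tendsto_integral_filter_of_dominated_convergence (fun a => 2 * g a)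
      (Eventually.of_forall hm) (Eventually.of_forall fun b => Eventually.of_forall (hbd b))
      (hg.const_mul 2) (Eventually.of_forall fun a => ?_)
    have h := ((hFf a).sub_const (f a)).norm.min (tendsto_const_nhds (x := 2 * g a))
    rwa [sub_self, norm_zero, min_eq_left (mul_nonneg zero_le_two (hg0 a))] at h
  have h2 : Tendsto (fun b => ∫ a, min (G b a) (g a) ∂μ) l (𝓝 (∫ a, g a ∂μ)) := by
    refine tendsto_integral_filter_of_dominated_convergence g
      (Eventually.of_forall fun b => (hmin b).aestronglyMeasurable)
      (Eventually.of_forall fun b => Eventually.of_forall fun a => ?_) hg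
      (Eventually.of_forall fun a => ?_)
    · rw [Real.norm_of_nonneg (le_min (hG0 b a) (hg0 a))]
      exact min_le_right _ _
    · simpa using (hGg a).min (tendsto_const_nhds (x := g a))
  have h3 := h1.add (hint.sub h2)
  simp only [integral_zero, sub_self, add_zero] at h3
  rw [tendsto_iff_norm_sub_tendsto_zero]
  refine squeeze_zero (fun _ => norm_nonneg _) (fun b => ?_) h3
  have hi1 : Integrable (fun a => min ‖F b a - f a‖ (2 * g a)) μ :=
    (hg.const_mul 2).mono' (hm b) (Eventually.of_forall (hbd b))
  have hi2 : Integrable (fun a => G b a - min (G b a) (g a)) μ := (hG b).sub (hmin b)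
  rw [← integral_sub (hFi b) hfi, ← integral_sub (hG b) (hmin b), ← integral_add hi1 hi2]
  refine (norm_integral_le_integral_norm _).trans
    (integral_mono ((hFi b).sub hfi).norm (hi1.add hi2) fun a => ?_)
  have h4 : ‖F b a - f a‖ ≤ G b a + g a :=
    (norm_sub_le _ _).trans (add_le_add (hFG b a) (hfg a))
  change ‖F b a - f a‖ ≤ min ‖F b a - f a‖ (2 * g a) + (G b a - min (G b a) (g a))
  rcases min_cases ‖F b a - f a‖ (2 * g a) with ⟨h, _⟩ | ⟨h, _⟩ <;>
  rcases min_cases (G b a) (g a) with ⟨h', _⟩ | ⟨h', _⟩ <;> rw [h, h'] <;> linarith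

end GeneralizedDominatedConvergence

/-! ### Monotonicity and second moments of class means. -/

section ClassMeanReal

variable {ι κ : Type*} {r : ι → ℝ} {ℓ : ι → κ} {f g : ι → ℝ}

theorem classMean_mono (hr : ∀ i, 0 < r i) (hf : Summable fun i => r i * f i)
    (hg : Summable fun i => r i * g i) (hfg : ∀ i, f i ≤ g i) (c : κ) :
    classMean r ℓ f c ≤ classMean r ℓ g c := by
  unfold classMean
  refine mul_le_mul_of_nonneg_left ?_ (inv_nonneg.2 (classWeight_nonneg hr c))
  exact Summable.tsum_le_tsum (fun k => mul_le_mul_of_nonneg_left (hfg k) (hr k).le)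
    (summable_fiber hf c) (summable_fiber hg c)

theorem summable_mul_of_summable_mul_sq (hr : ∀ i, 0 < r i) (hrs : Summable r)
    (hf : Summable fun i => r i * f i ^ 2) : Summable fun i => r i * |f i| := by
  refine (hrs.add hf).of_nonneg_of_le (fun i => mul_nonneg (hr i).le (abs_nonneg _)) fun i => ?_
  have h : |f i| ≤ 1 + f i ^ 2 := by
    rw [← sq_abs]; nlinarith [sq_nonneg (|f i| - 1), abs_nonneg (f i)]
  calc r i * |f i| ≤ r i * (1 + f i ^ 2) := mul_le_mul_of_nonneg_left h (hr i).le
    _ = _ := by ring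

/-- Averaging `2 m f ≤ m² + f²`, with `m` the mean itself, gives `2 m² ≤ m² + mean(f²)`. -/
theorem sq_classMean_le (hr : ∀ i, 0 < r i) (hrs : Summable r)
    (hf : Summable fun i => r i * f i ^ 2) (i : ι) :
    classMean r ℓ f (ℓ i) ^ 2 ≤ classMean r ℓ (fun k => f k ^ 2) (ℓ i) := by
  set m := classMean r ℓ f (ℓ i) with hm
  have hf1 : Summable fun i => r i * f i :=
    summable_smul_of_norm (φ := f) hr
      (by simpa using summable_mul_of_summable_mul_sq hr hrs hf)
  have e1 : classMean r ℓ (fun k => 2 * m * f k) (ℓ i) = 2 * m * m :=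
    classMean_clm ((2 * m) • ContinuousLinearMap.id ℝ ℝ) hf1 (ℓ i)
  have hs2 : Summable fun i => r i • m ^ 2 := hrs.smul_const _
  have e2 : classMean r ℓ (fun k => m ^ 2 + f k ^ 2) (ℓ i)
      = m ^ 2 + classMean r ℓ (fun k => f k ^ 2) (ℓ i) := by
    rw [classMean_add hs2 hf, classMean_const hr hrs]
  have h := classMean_mono (ℓ := ℓ) hr (f := fun k => 2 * m * f k)
    (g := fun k => m ^ 2 + f k ^ 2) ((hf1.mul_left (2 * m)).congr fun k => by ring)
    ((hs2.add hf).congr fun k => by simp only [smul_eq_mul]; ring)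
    (fun k => by nlinarith [sq_nonneg (m - f k)]) (ℓ i)
  rw [e1, e2] at h
  linarith

theorem norm_sq_classMean_le {E : Type*} [NormedAddCommGroup E] [NormedSpace ℝ E]
    [CompleteSpace E] {φ : ι → E} (hr : ∀ i, 0 < r i) (hrs : Summable r)
    (hφ : Summable fun i => r i * ‖φ i‖ ^ 2) (i : ι) :
    ‖classMean r ℓ φ (ℓ i)‖ ^ 2 ≤ classMean r ℓ (fun k => ‖φ k‖ ^ 2) (ℓ i) := by
  refine le_trans ?_ (sq_classMean_le hr hrs hφ i)
  refine pow_le_pow_left₀ (norm_nonneg _) (norm_classMean_le hr ?_ _) 2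
  simpa using summable_mul_of_summable_mul_sq hr hrs hφ

end ClassMeanReal

/-! ### Posterior means as orthogonal projections, and integrability of the log-density. -/

section Posterior

variable {ι κ : Type*} {q : ι → ℝ} {s : ι → ℂ} {ℓ : ι → κ}
  {E : Type*} [NormedAddCommGroup E] [NormedSpace ℝ E]

/-- The posterior mean of `φ` given the output and the class of the input index, as a function of
the input index and the noise. -/
noncomputable def postMean (q : ι → ℝ) (s : ι → ℂ) (ℓ : ι → κ) (φ : ι → E) (ω : ι × ℂ) : E :=
  classMean (outputWeight q s (s ω.1 + ω.2)) ℓ φ (ℓ ω.1)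

/-- The logarithm of the output density given the class of the input index. -/
noncomputable def logDensity (q : ι → ℝ) (s : ι → ℂ) (ℓ : ι → κ) (ω : ι × ℂ) : ℝ :=
  Real.log ((∑' k : {k // ℓ k = ℓ ω.1}, outputWeight q s (s ω.1 + ω.2) k) /
    ∑' k : {k // ℓ k = ℓ ω.1}, q k)

variable [MeasurableSpace ι] [DiscreteMeasurableSpace ι]

theorem memLp_fst [Countable ι] {φ : ι → ℂ} (hq : ∀ i, 0 < q i)
    (hφ : Summable fun i => q i * ‖φ i‖ ^ 2) :
    MemLp (fun ω : ι × ℂ => φ ω.1) 2 (jointLaw q) := by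
  refine (memLp_two_iff_integrable_sq_norm
    ((measurable_of_countable φ).comp measurable_fst).aestronglyMeasurable).2 ?_
  have h : Integrable (fun i => ‖φ i‖ ^ 2) (inputLaw q) :=
    (integrable_inputLaw_iff hq).2 (by simpa using hφ)
  exact h.comp_fst noiseLaw

theorem memLp_snd (hq : ∀ i, 0 < q i) (hqs : Summable q) :
    MemLp (fun ω : ι × ℂ => ω.2) 2 (jointLaw q) := by
  have := isFiniteMeasure_inputLaw hq hqs
  refine (memLp_two_iff_integrable_sq_norm measurable_snd.aestronglyMeasurable).2 ?_
  have h := (memLp_two_iff_integrable_sq_norm (by fun_prop)).1 memLp_noise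
  exact h.comp_snd (inputLaw q)

theorem isFiniteMeasure_jointLaw (hq : ∀ i, 0 < q i) (hqs : Summable q) :
    IsFiniteMeasure (jointLaw q) := by
  have := isFiniteMeasure_inputLaw hq hqs
  unfold jointLaw; infer_instance

theorem memLp_output [Countable ι] (hq : ∀ i, 0 < q i) (hqs : Summable q)
    (hs : Summable fun i => q i * ‖s i‖ ^ 2) :
    MemLp (fun ω : ι × ℂ => s ω.1 + ω.2) 2 (jointLaw q) :=
  (memLp_fst hq hs).add (memLp_snd hq hqs)

omit [DiscreteMeasurableSpace ι] in
-- Independence factors the integral and the noise has mean zero. The product formula needs no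
-- integrability of `φ`.
theorem integral_fst_mul_conj_noise [Countable ι] (φ : ι → ℂ) :
    ∫ ω, conj ω.2 * φ ω.1 ∂jointLaw q = 0 := by
  unfold jointLaw
  simp only [mul_comm (conj _)]
  rw [integral_prod_mul (L := ℂ) φ (fun w => conj w), integral_conj, integral_noise]
  simp

variable [Countable ι]

theorem measurable_postMean [CompleteSpace E] [MeasurableSpace E] [BorelSpace E]
    [SecondCountableTopology E] (φ : ι → E) : Measurable (postMean q s ℓ φ) :=
  measurable_classMean_output (Φ := fun k _ => φ k) fun _ => measurable_const

/-- The right-hand integral does not involve `s`. These posterior means therefore serve as bounds of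
constant integral in Pratt's lemma. -/
theorem integrable_postMean_norm_sq {φ : ι → ℂ} (hq : ∀ i, 0 < q i) (hqs : Summable q)
    (hφ : Summable fun i => q i * ‖φ i‖ ^ 2) :
    Integrable (postMean q s ℓ fun k => ‖φ k‖ ^ 2) (jointLaw q) ∧
    ∫ ω, postMean q s ℓ (fun k => ‖φ k‖ ^ 2) ω ∂jointLaw q = ∫ ω, ‖φ ω.1‖ ^ 2 ∂jointLaw q :=
  integrable_classMean hq hqs (Φ := fun k _ => ‖φ k‖ ^ 2) (fun _ => measurable_const)
    ((memLp_two_iff_integrable_sq_norm (memLp_fst hq hφ).1).1 (memLp_fst hq hφ))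

omit [MeasurableSpace ι] [DiscreteMeasurableSpace ι] [Countable ι] in
theorem norm_sq_postMean_le {φ : ι → ℂ} (hq : ∀ i, 0 < q i) (hqs : Summable q)
    (hφ : Summable fun i => q i * ‖φ i‖ ^ 2) (ω : ι × ℂ) :
    ‖postMean q s ℓ φ ω‖ ^ 2 ≤ postMean q s ℓ (fun k => ‖φ k‖ ^ 2) ω :=
  norm_sq_classMean_le (outputWeight_pos hq _) (summable_outputWeight hq hqs _)
    (summable_outputWeight_mul hq (fun _ => sq_nonneg _) hφ _) _

theorem memLp_postMean {φ : ι → ℂ} (hq : ∀ i, 0 < q i) (hqs : Summable q)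
    (hφ : Summable fun i => q i * ‖φ i‖ ^ 2) :
    MemLp (postMean q s ℓ φ) 2 (jointLaw q) := by
  have hm := (measurable_postMean (q := q) (s := s) (ℓ := ℓ) φ).aestronglyMeasurable
    (μ := jointLaw q)
  refine (memLp_two_iff_integrable_sq_norm hm).2 ?_
  refine (integrable_postMean_norm_sq (s := s) (ℓ := ℓ) hq hqs hφ).1.mono' (hm.norm.pow 2)
    (Filter.Eventually.of_forall fun ω => ?_)
  rw [Real.norm_of_nonneg (sq_nonneg _)]
  exact norm_sq_postMean_le hq hqs hφ ω

theorem integrable_conj_mul {α : Type*} [MeasurableSpace α] {μ : Measure α} {f g : α → ℂ}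
    (hf : MemLp f 2 μ) (hg : MemLp g 2 μ) : Integrable (fun a => conj (f a) * g a) μ :=
  MemLp.integrable_mul hf.star hg

omit [MeasurableSpace ι] [DiscreteMeasurableSpace ι] [Countable ι] in
theorem summable_outputWeight_mul_norm {φ : ι → ℂ} (hq : ∀ i, 0 < q i) (hqs : Summable q)
    (hφ : Summable fun i => q i * ‖φ i‖ ^ 2) (y : ℂ) :
    Summable fun i => outputWeight q s y i * ‖φ i‖ := by
  have h := summable_mul_of_summable_mul_sq hq hqs hφ
  simp only [abs_norm] at h
  exact summable_outputWeight_mul hq (fun _ => norm_nonneg _) h y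

omit [MeasurableSpace ι] [DiscreteMeasurableSpace ι] [Countable ι] in
theorem summable_outputWeight_smul {φ : ι → ℂ} (hq : ∀ i, 0 < q i) (hqs : Summable q)
    (hφ : Summable fun i => q i * ‖φ i‖ ^ 2) (y : ℂ) :
    Summable fun i => outputWeight q s y i • φ i :=
  summable_smul_of_norm (outputWeight_pos hq y) (summable_outputWeight_mul_norm hq hqs hφ y)

/-- The error of the posterior mean is orthogonal to every posterior mean. -/
theorem integral_conj_sub_postMean_mul_postMean {φ ψ : ι → ℂ} (hq : ∀ i, 0 < q i)
    (hqs : Summable q) (hφ : Summable fun i => q i * ‖φ i‖ ^ 2)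
    (hψ : Summable fun i => q i * ‖ψ i‖ ^ 2) :
    ∫ ω, conj (φ ω.1 - postMean q s ℓ φ ω) * postMean q s ℓ ψ ω ∂jointLaw q = 0 := by
  have hi := integrable_conj_mul ((memLp_fst hq hφ).sub
    (memLp_postMean (s := s) (ℓ := ℓ) hq hqs hφ))
    (memLp_postMean (s := s) (ℓ := ℓ) hq hqs hψ)
  have h := integrable_classMean (q := q) (s := s) (ℓ := ℓ) hq hqs (Φ := fun k y =>
    conj (φ k - classMean (outputWeight q s y) ℓ φ (ℓ k)) *
      classMean (outputWeight q s y) ℓ ψ (ℓ k)) (fun k => by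
        have h1 := measurable_classMean (q := q) (s := s) (ℓ := ℓ) (Φ := fun k _ => φ k)
          (fun _ => measurable_const) (ℓ k)
        have h2 := measurable_classMean (q := q) (s := s) (ℓ := ℓ) (Φ := fun k _ => ψ k)
          (fun _ => measurable_const) (ℓ k)
        exact (Complex.continuous_conj.measurable.comp (h1.const_sub _)).mul h2) hi
  refine h.2.symm.trans ?_
  rw [← integral_zero (ι × ℂ) ℂ]
  refine integral_congr_ae (Filter.Eventually.of_forall fun ω => ?_)
  set y := s ω.1 + ω.2
  have hw := outputWeight_pos (s := s) hq y
  have hws := summable_outputWeight (s := s) hq hqs y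
  -- Within a class the two posterior means are constants, so the product is a linear function of
  -- the error, whose class mean is zero. The map is only real-linear because of the conjugation.
  have e1 : classMean (outputWeight q s y) ℓ (fun k =>
      conj (φ k - classMean (outputWeight q s y) ℓ φ (ℓ k)) *
        classMean (outputWeight q s y) ℓ ψ (ℓ k)) (ℓ ω.1) =
      classMean (outputWeight q s y) ℓ (fun k =>
        (((ContinuousLinearMap.mul ℝ ℂ).flip (classMean (outputWeight q s y) ℓ ψ (ℓ ω.1))).comp
          (Complex.conjCLE : ℂ →L[ℝ] ℂ)) (φ k - classMean (outputWeight q s y) ℓ φ (ℓ ω.1)))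
        (ℓ ω.1) :=
    classMean_congr fun k hk => by simp [hk, mul_comm]
  have hs1 := summable_outputWeight_smul (s := s) hq hqs hφ y
  have hs2 : Summable fun i => outputWeight q s y i • classMean (outputWeight q s y) ℓ φ (ℓ ω.1) :=
    hws.smul_const _
  have hs3 : Summable fun i => outputWeight q s y i •
      (φ i - classMean (outputWeight q s y) ℓ φ (ℓ ω.1)) := by
    simpa only [smul_sub] using hs1.sub hs2
  refine e1.trans ?_
  rw [classMean_clm _ hs3, classMean_sub hs1 hs2, classMean_const hw hws, sub_self, map_zero]

/-- Posterior means are self-adjoint. -/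
theorem integral_conj_postMean_mul {φ ψ : ι → ℂ} (hq : ∀ i, 0 < q i)
    (hqs : Summable q) (hφ : Summable fun i => q i * ‖φ i‖ ^ 2)
    (hψ : Summable fun i => q i * ‖ψ i‖ ^ 2) :
    ∫ ω, conj (postMean q s ℓ φ ω) * ψ ω.1 ∂jointLaw q =
      ∫ ω, conj (postMean q s ℓ φ ω) * postMean q s ℓ ψ ω ∂jointLaw q := by
  have h := integral_conj_sub_postMean_mul_postMean (s := s) (ℓ := ℓ) hq hqs hψ hφ
  have hi1 := integrable_conj_mul (memLp_postMean (s := s) (ℓ := ℓ) hq hqs hφ) (memLp_fst hq hψ)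
  have hi2 := integrable_conj_mul (memLp_postMean (s := s) (ℓ := ℓ) hq hqs hφ)
    (memLp_postMean (s := s) (ℓ := ℓ) hq hqs hψ)
  rw [← sub_eq_zero, ← integral_sub hi1 hi2, ← map_eq_zero (starRingEnd ℂ), ← integral_conj, ← h]
  refine integral_congr_ae (Filter.Eventually.of_forall fun ω => ?_)
  simp only [map_mul, map_sub, Complex.conj_conj]
  ring

/-- The error is orthogonal to the posterior mean of `φ`, so subtracting that mean from the second
factor changes nothing. -/
theorem integral_conj_sub_postMean_mul_self {φ : ι → ℂ} (hq : ∀ i, 0 < q i)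
    (hqs : Summable q) (hφ : Summable fun i => q i * ‖φ i‖ ^ 2) :
    ∫ ω, conj (φ ω.1 - postMean q s ℓ φ ω) * φ ω.1 ∂jointLaw q =
      ((∫ ω, ‖φ ω.1 - postMean q s ℓ φ ω‖ ^ 2 ∂jointLaw q : ℝ) : ℂ) := by
  have h := integral_conj_sub_postMean_mul_postMean (s := s) (ℓ := ℓ) hq hqs hφ hφ
  have hd := (memLp_fst hq hφ).sub (memLp_postMean (s := s) (ℓ := ℓ) hq hqs hφ)
  have hi1 := integrable_conj_mul hd (memLp_fst hq hφ)
  have hi2 := integrable_conj_mul hd (memLp_postMean (s := s) (ℓ := ℓ) hq hqs hφ)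
  rw [← sub_zero (∫ ω, conj (φ ω.1 - postMean q s ℓ φ ω) * φ ω.1 ∂jointLaw q), ← h]
  refine (integral_sub hi1 hi2).symm.trans ?_
  rw [← integral_complex_ofReal]
  refine integral_congr_ae (Filter.Eventually.of_forall fun ω => ?_)
  simp only [Pi.sub_apply, ← mul_sub]
  rw [← Complex.normSq_eq_conj_mul_self, Complex.normSq_eq_norm_sq]

theorem measurable_logDensity : Measurable (logDensity q s ℓ) :=
  measurable_of_forall_left fun i => by
    unfold logDensity
    have h : Measurable fun w => ∑' k : {k // ℓ k = ℓ i}, outputWeight q s (s i + w) k :=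
      Measurable.tsum fun k =>
        (measurable_outputWeight (q := q) (s := s) k.1).comp (measurable_const_add (s i))
    exact Real.measurable_log.comp (h.div_const (∑' k : {k // ℓ k = ℓ i}, q k))

omit [MeasurableSpace ι] [DiscreteMeasurableSpace ι] [Countable ι] in
theorem logDensity_eq_sub (hq : ∀ i, 0 < q i) (hqs : Summable q) (ω : ι × ℂ) :
    logDensity q s ℓ ω =
      Real.log (∑' k : {k // ℓ k = ℓ ω.1}, outputWeight q s (s ω.1 + ω.2) k) -
        Real.log (∑' k : {k // ℓ k = ℓ ω.1}, q k) :=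
  Real.log_div (classWeight_pos (outputWeight_pos hq _) (summable_outputWeight hq hqs _) _).ne'
    (classWeight_pos hq hqs _).ne'

/-- Above, the density is at most `1 / π`. Below, Jensen's inequality under the prior weights bounds
its logarithm by the class mean of `-log π - ‖y - s k‖²`, hence by `‖y‖²` and the prior class mean
of `‖s‖²`, both integrable. -/
theorem integrable_logDensity (hq : ∀ i, 0 < q i) (hqs : Summable q)
    (hs : Summable fun i => q i * ‖s i‖ ^ 2) : Integrable (logDensity q s ℓ) (jointLaw q) := by
  have := isFiniteMeasure_jointLaw hq hqs
  have hB : Integrable (fun i => classMean q ℓ (fun k => ‖s k‖ ^ 2) (ℓ i)) (inputLaw q) := by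
    refine (integrable_inputLaw_iff hq).2 ?_
    have h := summable_mul_classMean_of_nonneg (ℓ := ℓ) hq hqs (fun _ => sq_nonneg _) hs
    refine h.congr fun i => ?_
    rw [Real.norm_of_nonneg (classMean_nonneg hq (fun _ => sq_nonneg _) _)]
  have hy : Integrable (fun ω : ι × ℂ => ‖s ω.1 + ω.2‖ ^ 2) (jointLaw q) :=
    (memLp_two_iff_integrable_sq_norm (memLp_output hq hqs hs).1).1 (memLp_output hq hqs hs)
  have hpi : 0 ≤ Real.log Real.pi := Real.log_nonneg (by linarith [Real.two_le_pi])
  refine (((integrable_const (Real.log Real.pi)).add (hy.const_mul 2)).add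
    ((hB.comp_fst noiseLaw).const_mul 2)).mono' measurable_logDensity.aestronglyMeasurable
    (Filter.Eventually.of_forall fun ω => ?_)
  change |logDensity q s ℓ ω| ≤ Real.log Real.pi + 2 * ‖s ω.1 + ω.2‖ ^ 2 +
    2 * classMean q ℓ (fun k => ‖s k‖ ^ 2) (ℓ ω.1)
  have hB0 : 0 ≤ classMean q ℓ (fun k => ‖s k‖ ^ 2) (ℓ ω.1) :=
    classMean_nonneg hq (fun _ => sq_nonneg _) _
  set y := s ω.1 + ω.2 with hydef
  have hw := outputWeight_pos (s := s) hq y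
  have hws := summable_outputWeight (s := s) hq hqs y
  have hQ := classWeight_pos (ℓ := ℓ) hq hqs ω.1
  refine abs_le.2 ⟨?_, ?_⟩
  · have hc : Summable fun i => q i • (-Real.log Real.pi - 2 * ‖y‖ ^ 2) := hqs.smul_const _
    have hs2 : Summable fun i => q i • ((-2 : ℝ) * ‖s i‖ ^ 2) :=
      (hs.mul_left (-2)).congr fun i => by simp only [smul_eq_mul]; ring
    have hd0 : Summable fun i => q i * |Real.log (noiseDensity (y - s i))| := by
      refine ((hqs.mul_right (Real.log Real.pi + 2 * ‖y‖ ^ 2)).add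
        (hs.mul_left 2)).of_nonneg_of_le (fun i => mul_nonneg (hq i).le (abs_nonneg _)) fun i => ?_
      have h1 : |Real.log (noiseDensity (y - s i))| ≤
          Real.log Real.pi + 2 * ‖y‖ ^ 2 + 2 * ‖s i‖ ^ 2 := by
        rw [log_noiseDensity, abs_le]
        have h2 : ‖y - s i‖ ^ 2 ≤ (‖y‖ + ‖s i‖) ^ 2 :=
          pow_le_pow_left₀ (norm_nonneg _) (norm_sub_le _ _) 2
        constructor <;> nlinarith [sq_nonneg (‖y‖ - ‖s i‖), sq_nonneg ‖y - s i‖]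
      calc _ ≤ q i * (Real.log Real.pi + 2 * ‖y‖ ^ 2 + 2 * ‖s i‖ ^ 2) :=
            mul_le_mul_of_nonneg_left h1 (hq i).le
        _ = _ := by ring
    have hJ := classMean_log_le (ℓ := ℓ) hq hqs hws
      (d := fun k => Real.log (noiseDensity (y - s k)))
      (fun i => by rw [Real.exp_log (noiseDensity_pos _)]; rfl) hd0 ω.1
    have hM := classMean_mono (ℓ := ℓ) hq
      (f := fun k => (-Real.log Real.pi - 2 * ‖y‖ ^ 2) + (-2 : ℝ) * ‖s k‖ ^ 2)
      (g := fun k => Real.log (noiseDensity (y - s k)))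
      ((hc.add hs2).congr fun i => by simp only [smul_eq_mul]; ring)
      (summable_smul_of_norm (φ := fun k => Real.log (noiseDensity (y - s k))) hq
        (by simpa using hd0))
      (fun k => by
        rw [log_noiseDensity]
        have h2 : ‖y - s k‖ ^ 2 ≤ (‖y‖ + ‖s k‖) ^ 2 :=
          pow_le_pow_left₀ (norm_nonneg _) (norm_sub_le _ _) 2
        nlinarith [sq_nonneg (‖y‖ - ‖s k‖)]) (ℓ ω.1)
    have e1 : classMean q ℓ (fun k => (-2 : ℝ) * ‖s k‖ ^ 2) (ℓ ω.1) =
        -2 * classMean q ℓ (fun k => ‖s k‖ ^ 2) (ℓ ω.1) :=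
      classMean_clm ((-2 : ℝ) • ContinuousLinearMap.id ℝ ℝ) hs (ℓ ω.1)
    rw [classMean_add hc hs2, classMean_const hq hqs, e1] at hM
    rw [logDensity_eq_sub hq hqs]
    linarith
  · have h1 : logDensity q s ℓ ω ≤ Real.log (1 / Real.pi) := by
      unfold logDensity
      refine Real.log_le_log (div_pos (classWeight_pos hw hws _) hQ) ?_
      rw [div_le_iff₀ hQ, ← tsum_mul_left]
      refine Summable.tsum_le_tsum (fun k => ?_) (summable_fiber hws _)
        ((summable_fiber hqs _).mul_left _)
      rw [mul_comm]
      exact outputWeight_le hq y k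
    rw [one_div, Real.log_inv] at h1
    nlinarith [sq_nonneg ‖y‖]

end Posterior

/-! ### Derivative of the expected log-density along an affine family of signals. -/

section Derivative

variable {ι κ : Type*} {q : ι → ℝ} {s : ι → ℂ} {ℓ : ι → κ}

/-- Decouples the true direction `a = v i`, fixed while averaging over the class, from the competing
direction `b = v k`; the price is a factor two in the quadratic remainder. -/
theorem norm_add_sq_le_of_real_smul (z a b : ℂ) (δ : ℝ) :
    -2 * δ * (conj z * a).re + 2 * δ * (conj z * b).re - 2 * δ ^ 2 * ‖a‖ ^ 2 - 2 * δ ^ 2 * ‖b‖ ^ 2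
      ≤ ‖z‖ ^ 2 - ‖z + δ * (a - b)‖ ^ 2 := by
  have h1 : ‖z + δ * (a - b)‖ ^ 2 = ‖z‖ ^ 2 + δ ^ 2 * ‖a - b‖ ^ 2 +
      2 * δ * ((conj z * a).re - (conj z * b).re) := by
    simp only [← Complex.normSq_eq_norm_sq, Complex.normSq_apply, Complex.mul_re, Complex.mul_im,
      Complex.add_re, Complex.add_im, Complex.sub_re, Complex.sub_im, Complex.conj_re,
      Complex.conj_im, Complex.ofReal_re, Complex.ofReal_im]
    ring
  have h2 : ‖a - b‖ ^ 2 ≤ 2 * ‖a‖ ^ 2 + 2 * ‖b‖ ^ 2 := by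
    have := pow_le_pow_left₀ (norm_nonneg _) (norm_sub_le a b) 2
    nlinarith [sq_nonneg (‖a‖ - ‖b‖)]
  nlinarith [mul_le_mul_of_nonneg_left h2 (sq_nonneg δ)]

/-- The noise is the same on both sides, so the output moves by `δ v i` when the signals move, and
Jensen's inequality is applied under the posterior at the old output. The part involving `v k` stays
a class mean, since it simplifies only after integration. -/
theorem logDensity_sub_ge (hq : ∀ i, 0 < q i) (hqs : Summable q)
    (hs : Summable fun i => q i * ‖s i‖ ^ 2) {v : ι → ℂ}
    (hv : Summable fun i => q i * ‖v i‖ ^ 2) (δ : ℝ) (ω : ι × ℂ) :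
    -2 * δ * (conj (s ω.1 + ω.2 - postMean q s ℓ s ω) * v ω.1).re - 2 * δ ^ 2 * ‖v ω.1‖ ^ 2 +
      classMean (outputWeight q s (s ω.1 + ω.2)) ℓ (fun k =>
        2 * δ * (conj (s ω.1 + ω.2 - s k) * v k).re - 2 * δ ^ 2 * ‖v k‖ ^ 2) (ℓ ω.1) ≤
      logDensity q (fun i => s i + δ * v i) ℓ ω - logDensity q s ℓ ω := by
  obtain ⟨i, w⟩ := ω
  dsimp only
  set y := s i + w with hy
  set r := outputWeight q s y with hr
  have hw : ∀ k, 0 < r k := outputWeight_pos hq y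
  have hws : Summable r := summable_outputWeight hq hqs y
  have hrs := summable_outputWeight_smul (s := s) hq hqs hs y
  have hrv2 : Summable fun k => r k * ‖v k‖ ^ 2 :=
    summable_outputWeight_mul hq (fun _ => sq_nonneg _) hv y
  have hrs2 : Summable fun k => r k * ‖s k‖ ^ 2 :=
    summable_outputWeight_mul hq (fun _ => sq_nonneg _) hs y
  have hry2 : Summable fun k => r k * ‖y‖ ^ 2 := hws.mul_right _
  have hz2 : Summable fun k => r k * ‖y - s k‖ ^ 2 := by
    refine ((hry2.mul_left 2).add (hrs2.mul_left 2)).of_nonneg_of_le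
      (fun k => mul_nonneg (hw k).le (sq_nonneg _)) fun k => ?_
    have h2 := pow_le_pow_left₀ (norm_nonneg _) (norm_sub_le y (s k)) 2
    have h3 : ‖y - s k‖ ^ 2 ≤ 2 * ‖y‖ ^ 2 + 2 * ‖s k‖ ^ 2 := by
      nlinarith [sq_nonneg (‖y‖ - ‖s k‖)]
    nlinarith [mul_le_mul_of_nonneg_left h3 (hw k).le]
  have hzs : Summable fun k => r k • (y - s k) := by
    simpa only [smul_sub] using (hws.smul_const y).sub hrs
  have hc : Summable fun k => r k • (-(2 * δ ^ 2 * ‖v i‖ ^ 2)) := hws.smul_const _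
  -- The log-likelihood change of candidate `k`: its residual `y - s k` becomes `y - s k + δ (v i -
  -- v k)`.
  set d : ι → ℝ := fun k => ‖y - s k‖ ^ 2 - ‖y - s k + δ * (v i - v k)‖ ^ 2 with hd
  set T : ℂ →L[ℝ] ℝ := (-2 * δ) • Complex.reCLM.comp
    (((ContinuousLinearMap.mul ℝ ℂ).flip (v i)).comp (Complex.conjCLE : ℂ →L[ℝ] ℂ)) with hT
  have hTz : ∀ z, T z = -2 * δ * (conj z * v i).re := fun z => by
    simp [hT, mul_comm]
  set D : ι → ℝ := fun k =>
    2 * δ * (conj (y - s k) * v k).re - 2 * δ ^ 2 * ‖v k‖ ^ 2 with hD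
  have hcross : Summable fun k => r k * |(conj (y - s k) * v k).re| := by
    refine (hz2.add hrv2).of_nonneg_of_le (fun k => mul_nonneg (hw k).le (abs_nonneg _))
      fun k => ?_
    have h1 : |(conj (y - s k) * v k).re| ≤ ‖y - s k‖ * ‖v k‖ := by
      refine (Complex.abs_re_le_norm _).trans_eq ?_
      rw [norm_mul, RCLike.norm_conj]
    have h2 : |(conj (y - s k) * v k).re| ≤ ‖y - s k‖ ^ 2 + ‖v k‖ ^ 2 := by
      nlinarith [sq_nonneg (‖y - s k‖ - ‖v k‖), sq_nonneg (‖y - s k‖ + ‖v k‖)]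
    nlinarith [mul_le_mul_of_nonneg_left h2 (hw k).le]
  have hcross' : Summable fun k => r k * (conj (y - s k) * v k).re :=
    summable_smul_of_norm (φ := fun k => (conj (y - s k) * v k).re) hw (by simpa using hcross)
  have hDs : Summable fun k => r k • D k :=
    ((hcross'.mul_left (2 * δ)).sub (hrv2.mul_left (2 * δ ^ 2))).congr fun k => by
      simp only [hD, smul_eq_mul]; ring
  have hTs : Summable fun k => r k • T (y - s k) := by
    simpa only [map_smul] using T.summable hzs
  have hdabs : Summable fun k => r k * |d k| := by
    refine ((hz2.mul_left 3).add (((hws.mul_right (‖v i‖ ^ 2)).add hrv2).mul_left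
      (4 * δ ^ 2))).of_nonneg_of_le (fun k => mul_nonneg (hw k).le (abs_nonneg _)) fun k => ?_
    have h1 : |d k| ≤ 3 * ‖y - s k‖ ^ 2 + 4 * δ ^ 2 * (‖v i‖ ^ 2 + ‖v k‖ ^ 2) := by
      have h2 : ‖v i - v k‖ ^ 2 ≤ 2 * ‖v i‖ ^ 2 + 2 * ‖v k‖ ^ 2 := by
        have := pow_le_pow_left₀ (norm_nonneg _) (norm_sub_le (v i) (v k)) 2
        nlinarith [sq_nonneg (‖v i‖ - ‖v k‖)]
      have h3 : ‖y - s k + δ * (v i - v k)‖ ^ 2 ≤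
          2 * ‖y - s k‖ ^ 2 + 2 * (δ ^ 2 * ‖v i - v k‖ ^ 2) := by
        have h4 := pow_le_pow_left₀ (norm_nonneg _)
          (norm_add_le (y - s k) ((δ : ℂ) * (v i - v k))) 2
        rw [norm_mul, Complex.norm_real, Real.norm_eq_abs] at h4
        have h5 : (|δ| * ‖v i - v k‖) ^ 2 = δ ^ 2 * ‖v i - v k‖ ^ 2 := by
          rw [mul_pow, sq_abs]
        nlinarith [sq_nonneg (‖y - s k‖ - |δ| * ‖v i - v k‖)]
      have h6 := mul_le_mul_of_nonneg_left h2 (sq_nonneg δ)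
      rw [abs_le]
      constructor <;> simp only [hd] <;>
        nlinarith [sq_nonneg ‖y - s k‖, sq_nonneg ‖y - s k + δ * (v i - v k)‖,
          mul_nonneg (sq_nonneg δ) (sq_nonneg ‖v i‖), mul_nonneg (sq_nonneg δ) (sq_nonneg ‖v k‖)]
    calc _ ≤ r k * (3 * ‖y - s k‖ ^ 2 + 4 * δ ^ 2 * (‖v i‖ ^ 2 + ‖v k‖ ^ 2)) :=
          mul_le_mul_of_nonneg_left h1 (hw k).le
      _ = _ := by ring
  have hJ := classMean_log_le (ℓ := ℓ) hw hws
    (summable_outputWeight (s := fun i => s i + δ * v i) hq hqs (s i + δ * v i + w)) (d := d)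
    (fun k => by
      simp only [hr, outputWeight, noiseDensity, hd]
      have e : s i + ↑δ * v i + w - (s k + ↑δ * v k) = y - s k + δ * (v i - v k) := by
        rw [hy]; ring
      rw [e, mul_assoc (q k), mul_assoc (1 / Real.pi), ← Real.exp_add]
      congr 3; ring) hdabs i
  have hM := classMean_mono (ℓ := ℓ) hw
    (f := fun k => T (y - s k) + -(2 * δ ^ 2 * ‖v i‖ ^ 2) + D k) (g := d)
    (((hTs.add hc).add hDs).congr fun k => by simp only [smul_eq_mul]; ring)
    (summable_smul_of_norm (φ := d) hw (by simpa using hdabs))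
    (fun k => by
      have := norm_add_sq_le_of_real_smul (y - s k) (v i) (v k) δ
      simp only [hTz, hD, hd]
      linarith) (ℓ i)
  have hTc : Summable fun k => r k • (T (y - s k) + -(2 * δ ^ 2 * ‖v i‖ ^ 2)) :=
    (hTs.add hc).congr fun k => by simp only [smul_eq_mul]; ring
  rw [classMean_add hTc hDs, classMean_add hTs hc, classMean_const hw hws,
    classMean_clm T hzs, classMean_sub (hws.smul_const y) hrs, classMean_const hw hws, hTz] at hM
  rw [logDensity_eq_sub hq hqs, logDensity_eq_sub hq hqs]
  have e : postMean q s ℓ s (i, w) = classMean r ℓ s (ℓ i) := rfl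
  rw [e]
  dsimp only
  linarith

variable [MeasurableSpace ι] [DiscreteMeasurableSpace ι] [Countable ι]

/-- By the tower property the leftover class mean integrates like its value at the true index, where
`y - s` is the noise. Both terms pairing the noise with `v` vanish, and the two remainders `2 δ²
‖v‖²` add up to the constant 4. -/
theorem integral_logDensity_sub_ge (hq : ∀ i, 0 < q i) (hqs : Summable q)
    (hs : Summable fun i => q i * ‖s i‖ ^ 2) {v : ι → ℂ}
    (hv : Summable fun i => q i * ‖v i‖ ^ 2) (δ : ℝ)
    (hs' : Summable fun i => q i * ‖s i + δ * v i‖ ^ 2) :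
    δ * (-2 * (∫ ω, conj (s ω.1 - postMean q s ℓ s ω) * v ω.1 ∂jointLaw q).re) -
      4 * (∫ ω, ‖v ω.1‖ ^ 2 ∂jointLaw q) * δ ^ 2 ≤
      ∫ ω, logDensity q (fun i => s i + δ * v i) ℓ ω ∂jointLaw q -
        ∫ ω, logDensity q s ℓ ω ∂jointLaw q := by
  rw [← integral_sub (integrable_logDensity hq hqs hs') (integrable_logDensity hq hqs hs)]
  have hv2 := (memLp_two_iff_integrable_sq_norm (memLp_fst hq hv).1).1 (memLp_fst hq hv)
  have hwv := integrable_conj_mul (memLp_snd hq hqs) (memLp_fst hq hv)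
  have hsv := integrable_conj_mul ((memLp_fst hq hs).sub
    (memLp_postMean (s := s) (ℓ := ℓ) hq hqs hs)) (memLp_fst hq hv)
  have hsplit : ∀ ω : ι × ℂ, conj (s ω.1 + ω.2 - postMean q s ℓ s ω) * v ω.1 =
      conj (s ω.1 - postMean q s ℓ s ω) * v ω.1 + conj ω.2 * v ω.1 := fun ω => by
    simp only [map_sub, map_add]; ring
  have hA : Integrable (fun ω => conj (s ω.1 + ω.2 - postMean q s ℓ s ω) * v ω.1)
      (jointLaw q) := by
    simp only [hsplit]; exact hsv.add hwv
  have hAint : ∫ ω, conj (s ω.1 + ω.2 - postMean q s ℓ s ω) * v ω.1 ∂jointLaw q =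
      ∫ ω, conj (s ω.1 - postMean q s ℓ s ω) * v ω.1 ∂jointLaw q := by
    simp only [hsplit]
    refine (integral_add hsv hwv).trans ?_
    rw [integral_fst_mul_conj_noise, add_zero]
    rfl
  have hDi : Integrable (fun ω : ι × ℂ =>
      2 * δ * (conj (s ω.1 + ω.2 - s ω.1) * v ω.1).re - 2 * δ ^ 2 * ‖v ω.1‖ ^ 2)
      (jointLaw q) := by
    simp only [add_sub_cancel_left]
    exact (hwv.re.const_mul _).sub (hv2.const_mul _)
  have hT := integrable_classMean (q := q) (s := s) (ℓ := ℓ) hq hqs (Φ := fun k y =>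
    2 * δ * (conj (y - s k) * v k).re - 2 * δ ^ 2 * ‖v k‖ ^ 2)
    (fun k => by
      refine Continuous.measurable ?_
      fun_prop) hDi
  have hTint : ∫ ω : ι × ℂ, (2 * δ * (conj (s ω.1 + ω.2 - s ω.1) * v ω.1).re -
      2 * δ ^ 2 * ‖v ω.1‖ ^ 2) ∂jointLaw q = -(2 * δ ^ 2 * ∫ ω, ‖v ω.1‖ ^ 2 ∂jointLaw q) := by
    simp only [add_sub_cancel_left]
    refine (integral_sub (hwv.re.const_mul (2 * δ)) (hv2.const_mul _)).trans ?_
    rw [integral_const_mul, integral_const_mul]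
    have h := integral_re hwv
    rw [integral_fst_mul_conj_noise] at h
    rw [h]
    simp
  have hfirst : Integrable (fun ω : ι × ℂ =>
      -2 * δ * (conj (s ω.1 + ω.2 - postMean q s ℓ s ω) * v ω.1).re - 2 * δ ^ 2 * ‖v ω.1‖ ^ 2)
      (jointLaw q) := (hA.re.const_mul (-2 * δ)).sub (hv2.const_mul (2 * δ ^ 2))
  have hfirstint : ∫ ω : ι × ℂ,
      (-2 * δ * (conj (s ω.1 + ω.2 - postMean q s ℓ s ω) * v ω.1).re - 2 * δ ^ 2 * ‖v ω.1‖ ^ 2)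
      ∂jointLaw q = -2 * δ * (∫ ω, conj (s ω.1 - postMean q s ℓ s ω) * v ω.1 ∂jointLaw q).re -
        2 * δ ^ 2 * ∫ ω, ‖v ω.1‖ ^ 2 ∂jointLaw q := by
    refine (integral_sub (hA.re.const_mul (-2 * δ)) (hv2.const_mul (2 * δ ^ 2))).trans ?_
    rw [integral_const_mul, integral_const_mul, integral_re hA, hAint]
    rfl
  have hmono := integral_mono (hfirst.add hT.1)
    ((integrable_logDensity hq hqs hs').sub (integrable_logDensity (ℓ := ℓ) hq hqs hs))
    (fun ω => logDensity_sub_ge (ℓ := ℓ) hq hqs hs hv δ ω)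
  have e := integral_add hfirst hT.1
  rw [hfirstint, hT.2, hTint] at e
  refine le_trans (le_of_eq ?_) hmono
  refine Eq.trans ?_ e.symm
  ring

open Filter Topology

omit [MeasurableSpace ι] [DiscreteMeasurableSpace ι] [Countable ι] in
-- The noise density is at most `1 / π`, which dominates numerator and denominator uniformly in `u`;
-- the denominator is positive at the limit.
theorem tendsto_postMean {E : Type*} [NormedAddCommGroup E] [NormedSpace ℝ E] [CompleteSpace E]
    {σ : ℝ → ι → ℂ} (hσ : ∀ i, Continuous fun u => σ u i)
    (hq : ∀ i, 0 < q i) (hqs : Summable q) {φ : ι → E} (hφ : Summable fun i => q i * ‖φ i‖)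
    (u : ℝ) (ω : ι × ℂ) :
    Tendsto (fun u => postMean q (σ u) ℓ φ ω) (𝓝 u) (𝓝 (postMean q (σ u) ℓ φ ω)) := by
  have hcont : ∀ k, Tendsto (fun u => outputWeight q (σ u) (σ u ω.1 + ω.2) k) (𝓝 u)
      (𝓝 (outputWeight q (σ u) (σ u ω.1 + ω.2) k)) := fun k => by
    have : Continuous fun u => outputWeight q (σ u) (σ u ω.1 + ω.2) k := by
      have h1 := hσ k
      have h2 := hσ ω.1
      unfold outputWeight; fun_prop
    exact this.tendsto u
  unfold postMean classMean
  refine Tendsto.smul (Tendsto.inv₀ ?_ ?_) ?_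
  · refine tendsto_tsum_of_dominated_convergence
      (bound := fun k : {k // ℓ k = ℓ ω.1} => q k * (1 / Real.pi))
      (summable_fiber (hqs.mul_right _) _) (fun k => hcont k)
      (Eventually.of_forall fun u k => ?_)
    rw [Real.norm_of_nonneg (outputWeight_pos hq _ _).le]
    exact outputWeight_le hq _ _
  · exact (classWeight_pos (outputWeight_pos hq _) (summable_outputWeight hq hqs _) _).ne'
  · refine tendsto_tsum_of_dominated_convergence
      (bound := fun k : {k // ℓ k = ℓ ω.1} => (1 / Real.pi) * (q k * ‖φ k‖))
      (summable_fiber (hφ.mul_left _) _) (fun k => (hcont k).smul_const _)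
      (Eventually.of_forall fun u k => ?_)
    rw [norm_smul, Real.norm_of_nonneg (outputWeight_pos hq _ _).le]
    calc _ ≤ q k * (1 / Real.pi) * ‖φ k‖ :=
          mul_le_mul_of_nonneg_right (outputWeight_le hq _ _) (norm_nonneg _)
      _ = _ := by ring

/-- The integrand is bounded by the posterior mean of `‖φ‖²` plus `‖v‖²`. This bound varies with
`u`, but its integral does not, so Pratt's lemma applies. -/
theorem continuous_integral_conj_postMean_mul {σ : ℝ → ι → ℂ}
    (hσ : ∀ i, Continuous fun u => σ u i) (hq : ∀ i, 0 < q i) (hqs : Summable q) {φ v : ι → ℂ}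
    (hφ : Summable fun i => q i * ‖φ i‖ ^ 2) (hv : Summable fun i => q i * ‖v i‖ ^ 2) :
    Continuous fun u => ∫ ω, conj (postMean q (σ u) ℓ φ ω) * v ω.1 ∂jointLaw q := by
  refine continuous_iff_continuousAt.2 fun u => ?_
  have hv2 := (memLp_two_iff_integrable_sq_norm (memLp_fst hq hv).1).1 (memLp_fst hq hv)
  have hG := fun u => integrable_postMean_norm_sq (s := σ u) (ℓ := ℓ) hq hqs hφ
  have hφ1 : Summable fun i => q i * ‖φ i‖ := by
    simpa using summable_mul_of_summable_mul_sq hq hqs hφ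
  refine tendsto_integral_of_tendsto_bound
    (G := fun u ω => postMean q (σ u) ℓ (fun k => ‖φ k‖ ^ 2) ω + ‖v ω.1‖ ^ 2)
    (g := fun ω => postMean q (σ u) ℓ (fun k => ‖φ k‖ ^ 2) ω + ‖v ω.1‖ ^ 2)
    (fun u => (integrable_conj_mul (memLp_postMean hq hqs hφ) (memLp_fst hq hv)).1)
    (integrable_conj_mul (memLp_postMean hq hqs hφ) (memLp_fst hq hv)).1
    (fun u => (hG u).1.add hv2) ((hG u).1.add hv2) (fun u ω => ?_) (fun ω => ?_) (fun ω => ?_) ?_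
  · have h := norm_sq_postMean_le (s := σ u) (ℓ := ℓ) hq hqs hφ ω
    rw [norm_mul, RCLike.norm_conj]
    nlinarith [sq_nonneg (‖postMean q (σ u) ℓ φ ω‖ - ‖v ω.1‖),
      sq_nonneg (‖postMean q (σ u) ℓ φ ω‖ + ‖v ω.1‖)]
  · exact ((Complex.continuous_conj.tendsto _).comp
      (tendsto_postMean hσ hq hqs hφ1 u ω)).mul_const _
  · exact (tendsto_postMean hσ hq hqs (φ := fun k => ‖φ k‖ ^ 2) (by simpa using hφ) u ω).add_const _
  · have e : ∀ u, ∫ ω, (postMean q (σ u) ℓ (fun k => ‖φ k‖ ^ 2) ω + ‖v ω.1‖ ^ 2) ∂jointLaw q =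
        ∫ ω, ‖φ ω.1‖ ^ 2 ∂jointLaw q + ∫ ω, ‖v ω.1‖ ^ 2 ∂jointLaw q := fun u => by
      rw [integral_add (hG u).1 hv2, (hG u).2]
    simp only [e]
    exact tendsto_const_nhds

/-- A function with a continuous family of subgradients, up to a quadratic error, is
differentiable. -/
theorem hasDerivAt_of_quadratic_lower_bound {J A : ℝ → ℝ} {C : ℝ} (hA : Continuous A)
    (h : ∀ u u', (u' - u) * A u - C * (u' - u) ^ 2 ≤ J u' - J u) (u : ℝ) :
    HasDerivAt J (A u) u := by
  rw [hasDerivAt_iff_isLittleO, Asymptotics.isLittleO_iff]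
  intro c hc
  have hlim : Tendsto (fun u' => |A u' - A u| + |C| * |u' - u|) (𝓝 u) (𝓝 0) := by
    have hcont : Continuous fun u' => |A u' - A u| + |C| * |u' - u| := by fun_prop
    simpa using hcont.tendsto u
  filter_upwards [hlim.eventually (gt_mem_nhds hc)] with u' hu'
  rw [Real.norm_eq_abs, Real.norm_eq_abs, smul_eq_mul]
  have h1 := h u u'
  -- With the roles exchanged, the lower bound becomes an upper bound with slope `A u'`, which is
  -- close to `A u`.
  have h2 := h u' u
  have hd : |J u' - J u - (u' - u) * A u| ≤ (|A u' - A u| + |C| * |u' - u|) * |u' - u| := by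
    have e1 : C * (u' - u) ^ 2 ≤ |C| * |u' - u| * |u' - u| := by
      rw [mul_assoc, ← sq, sq_abs]
      exact mul_le_mul_of_nonneg_right (le_abs_self _) (sq_nonneg _)
    have e2 : (u' - u) * (A u' - A u) ≤ |A u' - A u| * |u' - u| := by
      rw [← abs_mul, mul_comm]; exact le_abs_self _
    have e3 : 0 ≤ |A u' - A u| * |u' - u| := by positivity
    rw [abs_le]
    constructor <;> nlinarith
  exact hd.trans (mul_le_mul_of_nonneg_right hu'.le (abs_nonneg _))

omit [MeasurableSpace ι] [DiscreteMeasurableSpace ι] [Countable ι] in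
theorem summable_mul_norm_add_sq (hq : ∀ i, 0 < q i) {a b : ι → ℂ}
    (ha : Summable fun i => q i * ‖a i‖ ^ 2) (hb : Summable fun i => q i * ‖b i‖ ^ 2) :
    Summable fun i => q i * ‖a i + b i‖ ^ 2 := by
  refine ((ha.mul_left 2).add (hb.mul_left 2)).of_nonneg_of_le
    (fun i => mul_nonneg (hq i).le (sq_nonneg _)) fun i => ?_
  have h2 := pow_le_pow_left₀ (norm_nonneg _) (norm_add_le (a i) (b i)) 2
  have h3 : ‖a i + b i‖ ^ 2 ≤ 2 * ‖a i‖ ^ 2 + 2 * ‖b i‖ ^ 2 := by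
    nlinarith [sq_nonneg (‖a i‖ - ‖b i‖)]
  nlinarith [mul_le_mul_of_nonneg_left h3 (hq i).le]

omit [MeasurableSpace ι] [DiscreteMeasurableSpace ι] [Countable ι] in
theorem summable_mul_norm_const_mul_sq {a : ι → ℂ} (c : ℂ)
    (ha : Summable fun i => q i * ‖a i‖ ^ 2) : Summable fun i => q i * ‖c * a i‖ ^ 2 :=
  (ha.mul_left (‖c‖ ^ 2)).congr fun i => by rw [norm_mul]; ring

omit [MeasurableSpace ι] [DiscreteMeasurableSpace ι] [Countable ι] in
theorem postMean_const_mul {φ : ι → ℂ} (hq : ∀ i, 0 < q i) (hqs : Summable q)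
    (hφ : Summable fun i => q i * ‖φ i‖ ^ 2) (c : ℂ) (ω : ι × ℂ) :
    postMean q s ℓ (fun k => c * φ k) ω = c * postMean q s ℓ φ ω :=
  classMean_clm (ContinuousLinearMap.mul ℝ ℂ c) (summable_outputWeight_smul hq hqs hφ _) _

omit [MeasurableSpace ι] [DiscreteMeasurableSpace ι] [Countable ι] in
theorem postMean_add {φ ψ : ι → ℂ} (hq : ∀ i, 0 < q i) (hqs : Summable q)
    (hφ : Summable fun i => q i * ‖φ i‖ ^ 2) (hψ : Summable fun i => q i * ‖ψ i‖ ^ 2)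
    (ω : ι × ℂ) :
    postMean q s ℓ (fun k => φ k + ψ k) ω = postMean q s ℓ φ ω + postMean q s ℓ ψ ω :=
  classMean_add (summable_outputWeight_smul hq hqs hφ _) (summable_outputWeight_smul hq hqs hψ _) _

/-- The derivative of the negative conditional output entropy along the signals `u v + e`. -/
theorem hasDerivAt_integral_logDensity (hq : ∀ i, 0 < q i) (hqs : Summable q) {v e : ι → ℂ}
    (hv : Summable fun i => q i * ‖v i‖ ^ 2) (he : Summable fun i => q i * ‖e i‖ ^ 2) (u : ℝ) :
    HasDerivAt (fun u : ℝ => ∫ ω, logDensity q (fun i => u * v i + e i) ℓ ω ∂jointLaw q)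
      (-2 * (u * ∫ ω, ‖v ω.1 - postMean q (fun i => u * v i + e i) ℓ v ω‖ ^ 2 ∂jointLaw q +
        (∫ ω, conj (e ω.1 - postMean q (fun i => u * v i + e i) ℓ e ω) * v ω.1
          ∂jointLaw q).re)) u := by
  set σ : ℝ → ι → ℂ := fun u i => u * v i + e i with hσ
  have hσc : ∀ i, Continuous fun u => σ u i := fun i => by
    simp only [hσ]; fun_prop
  have hσs : ∀ u, Summable fun i => q i * ‖σ u i‖ ^ 2 := fun u =>
    summable_mul_norm_add_sq hq (summable_mul_norm_const_mul_sq _ hv) he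
  -- The posterior mean is linear and the signal is `u v + e`, so the slope splits into the error of
  -- `v` and the error of `e`.
  have hsplit : ∀ u, ∫ ω, conj (σ u ω.1 - postMean q (σ u) ℓ (σ u) ω) * v ω.1 ∂jointLaw q =
      u * ∫ ω, conj (v ω.1 - postMean q (σ u) ℓ v ω) * v ω.1 ∂jointLaw q +
        ∫ ω, conj (e ω.1 - postMean q (σ u) ℓ e ω) * v ω.1 ∂jointLaw q := fun u => by
    have h1 := integrable_conj_mul ((memLp_fst hq hv).sub
      (memLp_postMean (s := σ u) (ℓ := ℓ) hq hqs hv)) (memLp_fst hq hv)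
    have h2 := integrable_conj_mul ((memLp_fst hq he).sub
      (memLp_postMean (s := σ u) (ℓ := ℓ) hq hqs he)) (memLp_fst hq hv)
    rw [← integral_const_mul]
    refine Eq.trans ?_ (integral_add (h1.const_mul (u : ℂ)) h2)
    refine integral_congr_ae (Eventually.of_forall fun ω => ?_)
    have h3 : postMean q (σ u) ℓ (σ u) ω = u * postMean q (σ u) ℓ v ω + postMean q (σ u) ℓ e ω := by
      rw [← postMean_const_mul hq hqs hv]
      exact postMean_add hq hqs (summable_mul_norm_const_mul_sq _ hv) he ω
    have h4 : σ u ω.1 = u * v ω.1 + e ω.1 := rfl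
    simp only [h3, h4, map_sub, map_add, map_mul, Complex.conj_ofReal]
    ring
  have hsub : ∀ {φ : ι → ℂ}, (Summable fun i => q i * ‖φ i‖ ^ 2) →
      Continuous fun u => ∫ ω, conj (φ ω.1 - postMean q (σ u) ℓ φ ω) * v ω.1 ∂jointLaw q := by
    intro φ hφ
    have h : ∀ u, ∫ ω, conj (φ ω.1 - postMean q (σ u) ℓ φ ω) * v ω.1 ∂jointLaw q =
        ∫ ω, conj (φ ω.1) * v ω.1 ∂jointLaw q -
          ∫ ω, conj (postMean q (σ u) ℓ φ ω) * v ω.1 ∂jointLaw q := fun u => by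
      rw [← integral_sub (integrable_conj_mul (memLp_fst hq hφ) (memLp_fst hq hv))
        (integrable_conj_mul (memLp_postMean hq hqs hφ) (memLp_fst hq hv))]
      simp only [map_sub, sub_mul]
    simp only [h]
    exact continuous_const.sub (continuous_integral_conj_postMean_mul hσc hq hqs hφ hv)
  have hA : Continuous fun u =>
      -2 * (∫ ω, conj (σ u ω.1 - postMean q (σ u) ℓ (σ u) ω) * v ω.1 ∂jointLaw q).re := by
    simp only [hsplit]
    have h1 := hsub hv
    have h2 := hsub he
    fun_prop
  have hmain := hasDerivAt_of_quadratic_lower_bound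
    (J := fun u => ∫ ω, logDensity q (σ u) ℓ ω ∂jointLaw q)
    (C := 4 * (∫ ω, ‖v ω.1‖ ^ 2 ∂jointLaw q)) hA (fun u u' => by
      have e1 : (fun i => σ u i + ((u' - u : ℝ) : ℂ) * v i) = σ u' := by
        funext i; simp only [hσ]; push_cast; ring
      have h := integral_logDensity_sub_ge (ℓ := ℓ) hq hqs (hσs u) hv (u' - u)
        (by simpa only [congrFun e1 _] using hσs u')
      rwa [e1] at h) u
  convert hmain using 2
  rw [hsplit u, integral_conj_sub_postMean_mul_self hq hqs hv, Complex.add_re,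
    ← Complex.ofReal_mul, Complex.ofReal_re]

end Derivative

/-! ### Labels that reveal the signal or the interference. -/

section ClassFunction

variable {ι κ : Type*} {q : ι → ℝ} {s : ι → ℂ} {ℓ : ι → κ}

theorem postMean_eq_self {φ : ι → ℂ} (hq : ∀ i, 0 < q i) (hqs : Summable q)
    (hφ : ∀ i k, ℓ k = ℓ i → φ k = φ i) (ω : ι × ℂ) : postMean q s ℓ φ ω = φ ω.1 := by
  unfold postMean
  rw [classMean_congr (ψ := fun _ => φ ω.1) (hφ ω.1),
    classMean_const (outputWeight_pos hq _) (summable_outputWeight hq hqs _)]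

variable [MeasurableSpace ι] [DiscreteMeasurableSpace ι] [Countable ι] {v e : ι → ℂ}

/-- Here `v` is its own posterior mean: its error vanishes, and the error of `e` is orthogonal to
it. -/
theorem hasDerivAt_integral_logDensity_of_known_signal (hq : ∀ i, 0 < q i) (hqs : Summable q)
    (hv : Summable fun i => q i * ‖v i‖ ^ 2) (he : Summable fun i => q i * ‖e i‖ ^ 2)
    (hvℓ : ∀ i k, ℓ k = ℓ i → v k = v i) (u : ℝ) :
    HasDerivAt (fun u : ℝ => ∫ ω, logDensity q (fun i => u * v i + e i) ℓ ω ∂jointLaw q) 0 u := by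
  convert hasDerivAt_integral_logDensity (ℓ := ℓ) hq hqs hv he u using 1
  have h := integral_conj_sub_postMean_mul_postMean (s := fun i => u * v i + e i) (ℓ := ℓ)
    hq hqs he hv
  simp only [postMean_eq_self hq hqs hvℓ] at h ⊢
  rw [h]
  simp

theorem hasDerivAt_integral_logDensity_of_known_interference (hq : ∀ i, 0 < q i)
    (hqs : Summable q) (hv : Summable fun i => q i * ‖v i‖ ^ 2)
    (he : Summable fun i => q i * ‖e i‖ ^ 2) (heℓ : ∀ i k, ℓ k = ℓ i → e k = e i) (u : ℝ) :
    HasDerivAt (fun u : ℝ => ∫ ω, logDensity q (fun i => u * v i + e i) ℓ ω ∂jointLaw q)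
      (-2 * (u * ∫ ω, ‖v ω.1 - postMean q (fun i => u * v i + e i) ℓ v ω‖ ^ 2 ∂jointLaw q)) u := by
  convert hasDerivAt_integral_logDensity (ℓ := ℓ) hq hqs hv he u using 1
  simp [postMean_eq_self hq hqs heℓ]

/-- Self-adjointness of the posterior mean puts the one-sided error into the symmetric form of the
theorem. -/
theorem integral_conj_sub_postMean_mul (hq : ∀ i, 0 < q i) (hqs : Summable q)
    (hv : Summable fun i => q i * ‖v i‖ ^ 2) (he : Summable fun i => q i * ‖e i‖ ^ 2) :
    ∫ ω, conj (e ω.1 - postMean q s ℓ e ω) * v ω.1 ∂jointLaw q =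
      ∫ ω, (v ω.1 * conj (e ω.1) - postMean q s ℓ v ω * conj (postMean q s ℓ e ω))
        ∂jointLaw q := by
  have h1 := integrable_conj_mul (memLp_fst hq he) (memLp_fst hq hv)
  have h2 := integrable_conj_mul (memLp_postMean (s := s) (ℓ := ℓ) hq hqs he) (memLp_fst hq hv)
  have h3 := integrable_conj_mul (memLp_postMean (s := s) (ℓ := ℓ) hq hqs he)
    (memLp_postMean (s := s) (ℓ := ℓ) hq hqs hv)
  simp only [map_sub, sub_mul, mul_comm (v _), mul_comm (postMean q s ℓ v _)]
  rw [integral_sub h1 h2, integral_sub h1 h3, integral_conj_postMean_mul hq hqs he hv]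

end ClassFunction

/-! ### From the channel definitions to weights on the countable support. -/

section Bridge

variable (p : PMF (Fin 2 → ℂ)) (h : ℂ) (P : Fin 2 → ℝ)

/-- The probabilities of the input pairs in the support. -/
noncomputable def supportProb (i : p.support) : ℝ := (p i).toReal

/-- The noiseless channel output as a function of the input pair in the support. -/
noncomputable def supportSignal (i : p.support) : ℂ := signal h P i

instance : Countable p.support := p.support_countable.to_subtype

theorem supportProb_pos (i : p.support) : 0 < supportProb p i :=
  ENNReal.toReal_pos ((p.mem_support_iff i).1 i.2) (p.apply_ne_top i)

theorem summable_supportProb_mul_norm_sq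
    (hp : ∀ k, Summable fun x : Fin 2 → ℂ => (p x).toReal * ‖x k‖ ^ 2) (k : Fin 2) :
    Summable fun i : p.support => supportProb p i * ‖i.1 k‖ ^ 2 :=
  (hp k).subtype p.support

theorem summable_supportProb_mul_norm_const_mul_sq
    (hp : ∀ k, Summable fun x : Fin 2 → ℂ => (p x).toReal * ‖x k‖ ^ 2) (c : ℂ) (k : Fin 2) :
    Summable fun i : p.support => supportProb p i * ‖c * i.1 k‖ ^ 2 :=
  summable_mul_norm_const_mul_sq (a := fun i : p.support => i.1 k) c
    (summable_supportProb_mul_norm_sq p hp k)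

theorem summable_supportProb : Summable (supportProb p) :=
  (ENNReal.summable_toReal p.tsum_coe_ne_top).subtype p.support

theorem toMeasure_eq_map : p.toMeasure = (inputLaw (supportProb p)).map Subtype.val := by
  ext t ht
  rw [p.toMeasure_apply ht, Measure.map_apply measurable_subtype_coe ht, inputLaw,
    withDensity_apply _ (measurable_subtype_coe ht), ← lintegral_indicator
    (measurable_subtype_coe ht), lintegral_count]
  rw [← tsum_subtype_eq_of_support_subset (s := p.support)
    (fun x hx => by
      rw [PMF.mem_support_iff]
      intro h0
      exact hx (by by_cases h : x ∈ t <;> simp [h, h0]))]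
  refine tsum_congr fun i => ?_
  by_cases hi : (i : Fin 2 → ℂ) ∈ t
  · rw [Set.indicator_of_mem hi, Set.indicator_of_mem (by exact hi), supportProb,
      ENNReal.ofReal_toReal (p.apply_ne_top _)]
  · rw [Set.indicator_of_notMem hi, Set.indicator_of_notMem (by exact hi)]

theorem expect_eq {E : Type*} [NormedAddCommGroup E] [NormedSpace ℝ E]
    (g : (Fin 2 → ℂ) → ℂ → E) :
    expect p h P g =
      ∫ ω, g ω.1 (supportSignal p h P ω.1 + ω.2) ∂jointLaw (supportProb p) := by
  have := isFiniteMeasure_inputLaw (supportProb_pos p) (summable_supportProb p)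
  have hemb : MeasurableEmbedding (Subtype.val : p.support → (Fin 2 → ℂ)) :=
    MeasurableEmbedding.subtype_coe p.support_countable.measurableSet
  unfold expect
  have e : p.toMeasure.prod noiseLaw =
      (jointLaw (supportProb p)).map (Prod.map Subtype.val id) := by
    rw [toMeasure_eq_map, jointLaw, ← Measure.map_prod_map _ _ hemb.measurable measurable_id,
      Measure.map_id]
  rw [e, (hemb.prodMap MeasurableEmbedding.id).integral_map]
  rfl

variable {p} {κ : Type*} {ℓ : p.support → κ} {c : κ} {A : Set (Fin 2 → ℂ)}

/-- The conditioning event ranges over all inputs; terms off the support vanish, which leaves one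
class of the label. -/
theorem tsum_class_eq {E : Type*} [AddCommMonoid E] [TopologicalSpace E] {F : (Fin 2 → ℂ) → E}
    (hF : ∀ x, p x = 0 → F x = 0) (hA : ∀ i : p.support, (i : Fin 2 → ℂ) ∈ A ↔ ℓ i = c) :
    ∑' x : A, F x = ∑' k : {k // ℓ k = c}, F k.1 := by
  let g : {k // ℓ k = c} → A := fun k => ⟨k.1, (hA k.1).2 k.2⟩
  have hg : Function.Injective g := fun a b hab => by
    have h1 := congrArg Subtype.val hab
    exact Subtype.ext (Subtype.ext h1)
  refine (hg.tsum_eq (f := fun x : A => F x) fun x hx => ?_).symm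
  have hx' : (x : Fin 2 → ℂ) ∈ p.support := fun h0 => hx (hF x h0)
  exact ⟨⟨⟨x, hx'⟩, (hA ⟨x, hx'⟩).1 x.2⟩, rfl⟩

theorem tsum_class_density_eq (hA : ∀ i : p.support, (i : Fin 2 → ℂ) ∈ A ↔ ℓ i = c) (y : ℂ) :
    ∑' x : A, (p x).toReal * density h P x y =
      ∑' k : {k // ℓ k = c}, outputWeight (supportProb p) (supportSignal p h P) y k :=
  tsum_class_eq (F := fun x => (p x).toReal * density h P x y) (fun x hx => by simp [hx]) hA

theorem condDensity_eq (hA : ∀ i : p.support, (i : Fin 2 → ℂ) ∈ A ↔ ℓ i = c) (y : ℂ) :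
    condDensity p h P A y =
      (∑' k : {k // ℓ k = c}, outputWeight (supportProb p) (supportSignal p h P) y k) /
        ∑' k : {k // ℓ k = c}, supportProb p k := by
  unfold condDensity
  rw [tsum_class_density_eq h P hA, tsum_class_eq (F := fun x => (p x).toReal)
    (fun x hx => by simp [hx]) hA]
  rfl

theorem estimate_eq (hA : ∀ i : p.support, (i : Fin 2 → ℂ) ∈ A ↔ ℓ i = c) (k : Fin 2) (y : ℂ) :
    estimate p h P A k y =
      classMean (outputWeight (supportProb p) (supportSignal p h P) y) ℓ (fun i => i.1 k) c := by
  unfold estimate classMean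
  rw [tsum_class_density_eq h P hA, tsum_class_eq
    (F := fun x => (((p x).toReal * density h P x y : ℝ) : ℂ) * x k) (fun x hx => by simp [hx]) hA,
    div_eq_inv_mul, Complex.real_smul, Complex.ofReal_inv]
  rfl

theorem log_condDensity (ω : p.support × ℂ)
    (hA : ∀ i : p.support, (i : Fin 2 → ℂ) ∈ A ↔ ℓ i = ℓ ω.1) :
    Real.log (condDensity p h P A (supportSignal p h P ω.1 + ω.2)) =
      logDensity (supportProb p) (supportSignal p h P) ℓ ω := by
  rw [condDensity_eq h P hA]
  rfl

theorem condDensity_pos (ω : p.support × ℂ)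
    (hA : ∀ i : p.support, (i : Fin 2 → ℂ) ∈ A ↔ ℓ i = ℓ ω.1) (y : ℂ) :
    0 < condDensity p h P A y := by
  rw [condDensity_eq h P hA]
  exact div_pos (classWeight_pos (outputWeight_pos (supportProb_pos p) _)
    (summable_outputWeight (supportProb_pos p) (summable_supportProb p) _) _)
    (classWeight_pos (supportProb_pos p) (summable_supportProb p) _)

variable {j m : Fin 2}

theorem signal_eq (hjm : j ≠ m) (x : Fin 2 → ℂ) :
    signal h P x = (Real.sqrt (P j) : ℂ) * (h * x j) + h * Real.sqrt (P m) * x m := by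
  unfold signal
  fin_cases j <;> fin_cases m <;> simp_all [Fin.sum_univ_two] <;> ring

theorem supportSignal_eq (hjm : j ≠ m) :
    supportSignal p h P = fun i : p.support =>
      (Real.sqrt (P j) : ℂ) * (h * i.1 j) + h * Real.sqrt (P m) * i.1 m :=
  funext fun i => signal_eq h P hjm i.1

theorem supportSignal_update_eq (hjm : j ≠ m) (t : ℝ) :
    supportSignal p h (Function.update P j t) = fun i : p.support =>
      (Real.sqrt t : ℂ) * (h * i.1 j) + h * Real.sqrt (P m) * i.1 m := by
  rw [supportSignal_eq h _ hjm, Function.update_self, Function.update_of_ne hjm.symm]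

variable (hp : ∀ k, Summable fun x : Fin 2 → ℂ => (p x).toReal * ‖x k‖ ^ 2)
include hp

theorem summable_supportSignal (hjm : j ≠ m) :
    Summable fun i : p.support => supportProb p i * ‖supportSignal p h P i‖ ^ 2 := by
  rw [supportSignal_eq h P hjm]
  exact summable_mul_norm_add_sq (supportProb_pos p)
    (summable_mul_norm_const_mul_sq (a := fun i : p.support => h * i.1 j) _
      (summable_supportProb_mul_norm_const_mul_sq p hp h j))
    (summable_supportProb_mul_norm_const_mul_sq p hp _ m)

/-- The label `i.1 j` encodes conditioning on `x_j`, the unit label no conditioning. Positivity of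
the densities and integrability of their logarithms allow the split. -/
theorem mutualInfo_eq (β : ℝ) (hjm : j ≠ m) :
    mutualInfo β p h P j = (Real.log β)⁻¹ *
      (∫ ω, logDensity (supportProb p) (supportSignal p h P) (fun i => i.1 j) ω
          ∂jointLaw (supportProb p) -
        ∫ ω, logDensity (supportProb p) (supportSignal p h P) (fun _ => ()) ω
          ∂jointLaw (supportProb p)) := by
  have hs := summable_supportSignal h P hp hjm
  unfold mutualInfo
  rw [expect_eq, ← integral_sub
    (integrable_logDensity (supportProb_pos p) (summable_supportProb p) hs)
    (integrable_logDensity (supportProb_pos p) (summable_supportProb p) hs), ← integral_const_mul]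
  refine integral_congr_ae (Filter.Eventually.of_forall fun ω => ?_)
  have h1 : ∀ i : p.support, (i : Fin 2 → ℂ) ∈ {x' : Fin 2 → ℂ | x' j = ω.1.1 j} ↔
      i.1 j = ω.1.1 j := fun i => Iff.rfl
  have h2 : ∀ i : p.support, (i : Fin 2 → ℂ) ∈ (Set.univ : Set (Fin 2 → ℂ)) ↔ () = () :=
    fun i => by simp
  dsimp only
  rw [← log_condDensity h P (ℓ := fun i => i.1 j) ω h1,
    ← log_condDensity h P (ℓ := fun _ => ()) ω h2, Real.logb,
    Real.log_div (condDensity_pos h P (ℓ := fun i => i.1 j) ω h1 _).ne'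
      (condDensity_pos h P (ℓ := fun _ => ()) ω h2 _).ne', div_eq_inv_mul]

/-- Given both inputs the output density is that of the noise, so the first integral does not depend
on the powers. -/
theorem condMutualInfo_eq (β : ℝ) (hjm : j ≠ m) :
    condMutualInfo β p h P m = (Real.log β)⁻¹ *
      (∫ ω, Real.log (noiseDensity ω.2) ∂jointLaw (supportProb p) -
        ∫ ω, logDensity (supportProb p) (supportSignal p h P) (fun i => i.1 m) ω
          ∂jointLaw (supportProb p)) := by
  have hs := summable_supportSignal h P hp hjm
  have := isFiniteMeasure_jointLaw (supportProb_pos p) (summable_supportProb p)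
  have hn : Integrable (fun ω : p.support × ℂ => Real.log (noiseDensity ω.2))
      (jointLaw (supportProb p)) := by
    simp only [log_noiseDensity]
    have h2 := memLp_snd (supportProb_pos p) (summable_supportProb p)
    exact (integrable_const _).sub ((memLp_two_iff_integrable_sq_norm h2.1).1 h2)
  unfold condMutualInfo
  rw [expect_eq, ← integral_sub hn
    (integrable_logDensity (supportProb_pos p) (summable_supportProb p) hs), ← integral_const_mul]
  refine integral_congr_ae (Filter.Eventually.of_forall fun ω => ?_)
  have h1 : ∀ i : p.support, (i : Fin 2 → ℂ) ∈ {x' : Fin 2 → ℂ | x' m = ω.1.1 m} ↔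
      i.1 m = ω.1.1 m := fun i => Iff.rfl
  dsimp only
  have h2 : density h P ω.1 (supportSignal p h P ω.1 + ω.2) = noiseDensity ω.2 := by
    simp [density, supportSignal]
  rw [← log_condDensity h P (ℓ := fun i => i.1 m) ω h1, Real.logb, h2,
    Real.log_div (noiseDensity_pos _).ne'
      (condDensity_pos h P (ℓ := fun i => i.1 m) ω h1 _).ne', div_eq_inv_mul]

theorem norm_sq_mul_integral_norm_sub_postMean (k : Fin 2) :
    ‖h‖ ^ 2 * ∫ ω, ‖ω.1.1 k - postMean (supportProb p) (supportSignal p h P) ℓ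
        (fun i => i.1 k) ω‖ ^ 2 ∂jointLaw (supportProb p) =
      ∫ ω, ‖h * ω.1.1 k - postMean (supportProb p) (supportSignal p h P) ℓ
        (fun i => h * i.1 k) ω‖ ^ 2 ∂jointLaw (supportProb p) := by
  rw [← integral_const_mul]
  refine integral_congr_ae (Filter.Eventually.of_forall fun ω => ?_)
  dsimp only
  rw [postMean_const_mul (supportProb_pos p) (summable_supportProb p)
    (summable_supportProb_mul_norm_sq p hp k), ← mul_sub, norm_mul, mul_pow]

theorem norm_sq_mul_mmse (k : Fin 2) :
    ‖h‖ ^ 2 * mmse p h P k =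
      ∫ ω, ‖h * ω.1.1 k - postMean (supportProb p) (supportSignal p h P) (fun _ => ())
        (fun i => h * i.1 k) ω‖ ^ 2 ∂jointLaw (supportProb p) := by
  unfold mmse
  rw [expect_eq, ← norm_sq_mul_integral_norm_sub_postMean h P hp k]
  congr 1
  refine integral_congr_ae (Filter.Eventually.of_forall fun ω => ?_)
  dsimp only
  rw [estimate_eq h P (ℓ := fun _ => ()) (c := ()) (fun i => by simp)]
  rfl

theorem norm_sq_mul_condMmse (k m : Fin 2) :
    ‖h‖ ^ 2 * condMmse p h P k m =
      ∫ ω, ‖h * ω.1.1 k - postMean (supportProb p) (supportSignal p h P) (fun i => i.1 m)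
        (fun i => h * i.1 k) ω‖ ^ 2 ∂jointLaw (supportProb p) := by
  unfold condMmse
  rw [expect_eq, ← norm_sq_mul_integral_norm_sub_postMean h P hp k]
  congr 1
  refine integral_congr_ae (Filter.Eventually.of_forall fun ω => ?_)
  dsimp only
  rw [estimate_eq h P (ℓ := fun i => i.1 m) (c := ω.1.1 m) (fun i => Iff.rfl)]
  rfl

/-- Both `v = h x_j` and `e = h √P_m x_m` carry the fading coefficient; `h conj h = ‖h‖²` comes out
of their pairing. -/
theorem norm_sq_mul_crossCorrelation (j m : Fin 2) :
    ‖h‖ ^ 2 * Real.sqrt (P m) *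
      (expect p h P fun x y => x j * conj (x m) - estimate p h P Set.univ j y *
        conj (estimate p h P Set.univ m y)).re =
      (∫ ω, conj (h * Real.sqrt (P m) * ω.1.1 m - postMean (supportProb p) (supportSignal p h P)
        (fun _ => ()) (fun i => h * Real.sqrt (P m) * i.1 m) ω) * (h * ω.1.1 j)
        ∂jointLaw (supportProb p)).re := by
  have hj := summable_supportProb_mul_norm_sq p hp j
  have hm := summable_supportProb_mul_norm_sq p hp m
  rw [integral_conj_sub_postMean_mul (supportProb_pos p) (summable_supportProb p)
    (summable_supportProb_mul_norm_const_mul_sq p hp h j)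
    (summable_supportProb_mul_norm_const_mul_sq p hp _ m), expect_eq,
    ← Complex.re_ofReal_mul, ← integral_const_mul]
  congr 1
  refine integral_congr_ae (Filter.Eventually.of_forall fun ω => ?_)
  dsimp only
  rw [postMean_const_mul (supportProb_pos p) (summable_supportProb p) hj,
    postMean_const_mul (supportProb_pos p) (summable_supportProb p) hm,
    estimate_eq h P (ℓ := fun _ => ()) (c := ()) (fun i => by simp),
    estimate_eq h P (ℓ := fun _ => ()) (c := ()) (fun i => by simp)]
  change _ * (_ - postMean (supportProb p) (supportSignal p h P) (fun _ => ())
    (fun i => i.1 j) ω * conj (postMean (supportProb p) (supportSignal p h P) (fun _ => ())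
    (fun i => i.1 m) ω)) = _
  have hh : ((‖h‖ ^ 2 * Real.sqrt (P m) : ℝ) : ℂ) = h * conj h * Real.sqrt (P m) := by
    rw [Complex.mul_conj, Complex.normSq_eq_norm_sq]; push_cast; ring
  rw [hh]
  simp only [map_mul, Complex.conj_ofReal]
  ring

end Bridge

end BroadcastChannel

/-! ### The theorem, by the chain rule through `√P_j`. -/

open BroadcastChannel in
theorem theorem1 (β : ℝ) (hβ : 1 < β) (p : PMF (Fin 2 → ℂ))
    (hp : ∀ k, Summable fun x : Fin 2 → ℂ => (p x).toReal * ‖x k‖ ^ 2)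
    (h : Fin 2 → ℂ) (P : Fin 2 → ℝ) (j m : Fin 2) (hjm : j ≠ m) (hPj : 0 < P j) (hPm : 0 ≤ P m) :
    HasDerivAt (fun t : ℝ => BroadcastChannel.mutualInfo β p (h j) (Function.update P j t) j)
      ((Real.log β)⁻¹ *
        (‖h j‖ ^ 2 * BroadcastChannel.mmse p (h j) P j +
          ‖h j‖ ^ 2 * Real.sqrt (P m / P j) *
            (BroadcastChannel.expect p (h j) P fun x y =>
              x j * conj (x m) -
                BroadcastChannel.estimate p (h j) P Set.univ j y *
                  conj (BroadcastChannel.estimate p (h j) P Set.univ m y)).re))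
      (P j) ∧
    HasDerivAt (fun t : ℝ => BroadcastChannel.condMutualInfo β p (h j) (Function.update P j t) m)
      ((Real.log β)⁻¹ * (‖h j‖ ^ 2 * BroadcastChannel.condMmse p (h j) P j m))
      (P j) := by
  have hv := summable_supportProb_mul_norm_const_mul_sq p hp (h j) j
  have he := summable_supportProb_mul_norm_const_mul_sq p hp (h j * Real.sqrt (P m)) m
  have hq := supportProb_pos p
  have hqs := summable_supportProb p
  have hsqrt := Real.hasDerivAt_sqrt hPj.ne'
  have hpos : 0 < Real.sqrt (P j) := Real.sqrt_pos.2 hPj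
  have hsig := supportSignal_eq (p := p) (h j) P hjm
  constructor
  · simp only [mutualInfo_eq (h j) _ hp β hjm, supportSignal_update_eq (h j) P hjm]
    have h1 := (hasDerivAt_integral_logDensity_of_known_signal (ℓ := fun i : p.support => i.1 j)
      hq hqs hv he (fun i k hk => by rw [hk]) (Real.sqrt (P j))).comp (P j) hsqrt
    rw [Function.comp_def] at h1
    have h2 := (hasDerivAt_integral_logDensity (ℓ := fun _ : p.support => ())
      hq hqs hv he (Real.sqrt (P j))).comp (P j) hsqrt
    rw [Function.comp_def] at h2
    refine ((h1.sub h2).const_mul (Real.log β)⁻¹).congr_deriv ?_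
    rw [← hsig, ← norm_sq_mul_mmse (h j) P hp j, ← norm_sq_mul_crossCorrelation (h j) P hp j m,
      -- The chain rule factor `1 / (2 √P_j)` cancels the `2 √P_j` before the MMSE; in the cross
      -- term it leaves `√P_m / √P_j`.
      Real.sqrt_div hPm]
    field_simp
    ring
  · simp only [condMutualInfo_eq (h j) _ hp β hjm, supportSignal_update_eq (h j) P hjm]
    have h2 := (hasDerivAt_integral_logDensity_of_known_interference
      (ℓ := fun i : p.support => i.1 m)
      hq hqs hv he (fun i k hk => by rw [hk]) (Real.sqrt (P j))).comp (P j) hsqrt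
    rw [Function.comp_def] at h2
    refine ((h2.const_sub _).const_mul (Real.log β)⁻¹).congr_deriv ?_
    rw [← hsig, ← norm_sq_mul_condMmse (h j) P hp j m]
    field_simp
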